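/- Lemma 2.9. Let $k$ be an algebraic closure of a finite field of characteristic $p$, let $\ell\neq p$ be a prime, and let $I$ be the absolute Galois group of $k((t))$. For a continuous finite-dimensional $\overline{\mathbb{Q}}_\ell$-representation $U$ of $I$ and a rational number $x\ge 0$, let $U(x)$ denote the slope-$x$ part of $U$, that is, the largest subrepresentation on which the upper numbering ramification groups $I^{(y)}$ with $y>x$ act trivially and, if $x>0$, on which $I^{(x)}$ has no non-zero fixed vector. Let $V$ and $W$ be continuous finite-dimensional $\overline{\mathbb{Q}}_\ell$-representations of $I$, and let $x=\frac{n}{d}$ be a non-negative rational number written in lowest terms (integers $n\ge 0$, $d\ge 1$, $\gcd(n,d)=1$) with $p\nmid d$ and $n<p$. Then $$\dim\big((V\otimes W)(x)\big)\ \ge\ \dim V(x)\cdot\dim W(x)\cdot\Big(1-\frac1d\Big).$$ -/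

import Mathlib

open scoped LaurentSeries PowerSeries TensorProduct

noncomputable section

/-! ### Ramification filtrations -/

section Ramification

variable (A K L : Type*) [CommRing A] [Field K] [Field L]
  [Algebra A K] [Algebra A L] [Algebra K L] [IsScalarTower A K L]

/-- The lower numbering ramification group `G_m` of `G = Gal(L/K)`, for `m ≥ 0`: with `B` the
integral closure of `A` in `L` and `𝔪` the Jacobson radical of `B` (its maximal ideal when `B` is
local, as it is when `A` is a complete discrete valuation ring with fraction field `K` and `L/K`
is finite), the group of all `σ` with `σ b - b ∈ 𝔪 ^ (m + 1)` for all `b ∈ B`. -/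
def lowerRamificationGroup (m : ℕ) : Subgroup Gal(L/K) :=
  Ideal.inertia Gal(L/K) ((Ideal.jacobson (⊥ : Ideal (integralClosure A L))) ^ (m + 1))

/-- The Herbrand function `φ(u) = ∫_0^u dt / [G_0 : G_t]` (with `G_t = G_⌈t⌉`) of `L/K` at the
integer `u = m ≥ 0`, that is `(|G_1| + ⋯ + |G_m|) / |G_0|`. -/
def herbrand (m : ℕ) : ℝ :=
  (∑ i ∈ Finset.Icc 1 m, (Nat.card (lowerRamificationGroup A K L i) : ℝ)) /
    (Nat.card (lowerRamificationGroup A K L 0) : ℝ)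

/-- The upper numbering ramification group `G^y = G_{φ⁻¹(y)}` of `G = Gal(L/K)`, for real `y ≥ 0`.
As `φ` is strictly increasing, `⌈φ⁻¹(y)⌉` is the least integer `m ≥ 0` with `y ≤ φ(m)`. -/
def upperRamificationGroup (y : ℝ) : Subgroup Gal(L/K) :=
  lowerRamificationGroup A K L (sInf {m : ℕ | y ≤ herbrand A K L m})

end Ramification

/-! ### The inertia group of `k((t))` -/

section Inertia

variable (k : Type*) [Field k]

/-- The absolute Galois group `I` of `k((t))`, with its Krull topology. -/
abbrev InertiaGroup : Type _ := Gal(SeparableClosure k⸨X⸩/k⸨X⸩)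

/-- The upper numbering filtration `I^(y)`, `y ≥ 0`, of `I`: the elements whose restriction to every
finite Galois extension `L/k((t))` lies in `Gal(L/k((t)))^y`. -/
def upperRamification (y : ℝ) : Subgroup (InertiaGroup k) :=
  ⨅ L : FiniteGaloisIntermediateField k⸨X⸩ (SeparableClosure k⸨X⸩),
    (upperRamificationGroup k⟦X⟧ k⸨X⸩ L y).comap (AlgEquiv.restrictNormalHom L)

end Inertia

/-! ### `ℓ`-adic representations of `I` and their slopes -/

section Slopes

variable {k : Type*} [Field k] {ℓ : ℕ} [Fact ℓ.Prime]
  {V : Type*} [AddCommGroup V] [Module (PadicAlgCl ℓ) V]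

/-- Continuity, for the `ℓ`-adic topology, of a representation of `I` on a finite-dimensional
`ℚ̄_ℓ`-vector space: all matrix coefficients are continuous. -/
def IsContinuousRep (ρ : Representation (PadicAlgCl ℓ) (InertiaGroup k) V) : Prop :=
  ∀ (v : V) (f : Module.Dual (PadicAlgCl ℓ) V), Continuous fun g => f (ρ g v)

/-- `U` is a subrepresentation purely of slope `x`: the groups `I^(y)` with `y > x` act trivially
on `U` and, if `x ≠ 0`, `I^(x)` fixes no non-zero vector of `U`. -/
structure IsPureOfSlope (ρ : Representation (PadicAlgCl ℓ) (InertiaGroup k) V) (x : ℝ)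
    (U : Submodule (PadicAlgCl ℓ) V) : Prop where
  stable : ∀ g, ∀ u ∈ U, ρ g u ∈ U
  trivial_above : ∀ y > x, ∀ g ∈ upperRamification k y, ∀ u ∈ U, ρ g u = u
  no_fixed : x ≠ 0 → ∀ u ∈ U, (∀ g ∈ upperRamification k x, ρ g u = u) → u = 0

/-- The slope-`x` part `V(x)` of `V` for `x ≥ 0`: the largest subrepresentation purely of
slope `x`. -/
def slopePart (ρ : Representation (PadicAlgCl ℓ) (InertiaGroup k) V) (x : ℝ) :
    Submodule (PadicAlgCl ℓ) V :=
  sSup {U | IsPureOfSlope ρ x U}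

end Slopes

end

/-! If n = 0 then d = 1 and the right-hand side vanishes, so let x = n/d > 0. The group I^(x) is
pro-p and ℓ ≠ p, so it acts on V and W through a finite group: there is a finite Galois L/k((t)),
with group G, such that elements of I^(x) trivial on L act trivially
(`exists_forall_restrict_eq_one_apply_eq_one`). By Herbrand's theorem and compactness, I^(x) maps
onto G^x = G_{i+1} for some i ≥ 0. If x < φ(i+1), then V(x) = 0. Otherwise x = φ(i+1), and I^(x)
acts on A = V(x) and B = W(x) through G_{i+1}/G_{i+2}, which the wild character embeds in the
residue field. Conjugation by s in G multiplies the wild character by θ(s)^{i+1}, where θ is the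
tame character.

Let s generate G modulo G_1, let e be the order of θ(s), and ζ = θ(s)^{i+1}. The equality x = φ(i+1)
reads d(|G_1| + ... + |G_{i+1}|) = n|G_0|. Since |G_0| = e p^l and |G_1| + ... + |G_m| ≡ m|G_m| mod
e, coprimality of d to n and p forces 1, ζ, ..., ζ^{d-1} to be distinct (`exists_conj_surjective`).

The invariants of I^(x) in A ⊗ B are the image of an averaging projector. Twisting the action on B
by conjugation by s^j, for 0 ≤ j < d, gives an isomorphic action, because B carries an action of all
of I; so the d resulting projectors have equal rank. For a ≠ b, a vector fixed by both the a-th and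
the b-th twist is fixed by 1 ⊗ β of every element (s^a r s^{-a})(s^b r s^{-b})^{-1}. As ζ^a - ζ^b is
invertible, these exhaust G_{i+1}/G_{i+2}, and B has no invariants, so the vector is zero.
Orthogonality of the projectors gives d · dim (A ⊗ B)^{I^(x)} ≤ dim A · dim B
(`card_mul_finrank_range_mean_tprod_le`). The kernel of the untwisted projector is pure of slope x
and has the required dimension (`isPureOfSlope_map_ker_mean`). -/

noncomputable section

/-! ### The ring of integers of a finite extension of `k((t))` -/

open Polynomial IsLocalRing in
/-- Over a complete local domain, an irreducible monic polynomial whose constant term lies in the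
maximal ideal reduces to a power of the variable. -/
theorem map_residue_eq_X_pow_of_irreducible {A : Type*} [CommRing A] [IsDomain A] [IsLocalRing A]
    [IsAdicComplete (maximalIdeal A) A] {f : A[X]} (hf : f.Monic) (hirr : Irreducible f)
    (h0 : f.coeff 0 ∈ maximalIdeal A) :
    f.map (Ideal.Quotient.mk (maximalIdeal A)) = X ^ f.natDegree := by
  have hne : (f : PowerSeries A).map (residue A) ≠ 0 := by
    rw [← Polynomial.polynomial_map_coe]
    exact_mod_cast f.map_monic_ne_zero (f := residue A) hf
  obtain ⟨g, h, H⟩ := PowerSeries.exists_isWeierstrassFactorization hne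
  have hg := H.isDistinguishedAt
  have hmne : maximalIdeal A ≠ ⊤ := Ideal.IsMaximal.ne_top inferInstance
  have hgW : PowerSeries.IsWeierstrassDivisorAt (g : PowerSeries A) (maximalIdeal A) :=
    hg.isWeierstrassDivisorAt hmne
  have hord : (g.natDegree : ℕ∞) =
      ((g : PowerSeries A).map (Ideal.Quotient.mk (maximalIdeal A))).order :=
    hg.coe_natDegree_eq_order_map (g : PowerSeries A) 1
      (by rwa [PowerSeries.constantCoeff_one, ← Ideal.ne_top_iff_one]) (by simp)
  have hord' : ((g : PowerSeries A).map (Ideal.Quotient.mk (maximalIdeal A))).order.toNat =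
      g.natDegree := by rw [← hord]; simp
  have hdiv : g ∣ f := by
    rw [← Polynomial.modByMonic_eq_zero_iff_dvd hg.monic]
    -- Weierstrass division by g is unique: f = g h + 0 and the Euclidean division of f by g are
    -- both instances, so the polynomial remainder is zero.
    have key := hgW.eq_of_mul_add_eq_mul_add (q := h) (q' := ((f /ₘ g : A[X]) : PowerSeries A))
      (r := 0) (r' := f %ₘ g) (by rw [degree_zero]; exact WithBot.bot_lt_coe _) ?_ ?_
    · exact key.2.symm
    · rw [hord', ← degree_eq_natDegree hg.monic.ne_zero]
      exact degree_modByMonic_lt _ hg.monic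
    · rw [← H.eq_mul, Polynomial.coe_zero, add_zero, ← Polynomial.coe_mul, ← Polynomial.coe_add,
        add_comm, Polynomial.modByMonic_add_div f g]
  have hgnu : ¬ IsUnit g := by
    intro hu
    have h1 : g = 1 := hg.monic.eq_one_of_isUnit hu
    have := H.eq_mul
    rw [h1, Polynomial.coe_one, one_mul] at this
    have hu' := H.isUnit
    rw [← this, PowerSeries.isUnit_iff_constantCoeff] at hu'
    rw [← PowerSeries.coeff_zero_eq_constantCoeff_apply, Polynomial.coeff_coe] at hu'
    exact (mem_maximalIdeal _).1 h0 hu'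
  have hfg : Associated f g := (hirr.dvd_iff.1 hdiv).resolve_left hgnu
  have : f = g := eq_of_monic_of_associated hf hg.monic hfg
  rw [this]
  exact hg.map_eq_X_pow

/-! ### Integral extensions of complete local domains with algebraically closed residue field -/

section IntegralDomain

open IsLocalRing

variable {k A B : Type*} [Field k] [IsAlgClosed k] [CommRing A] [IsDomain A] [IsLocalRing A]
  [IsAdicComplete (maximalIdeal A) A] [CommRing B] [IsDomain B]
  [Algebra A B] [Algebra.IsIntegral A B]

-- A root of the reduced minimal polynomial of b exists in k. Shifting the minimal polynomial by its
-- lift `c x` gives an irreducible polynomial with constant term in the maximal ideal, hence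
-- congruent to a power of the variable; evaluate it at b - c x.
open Polynomial in
theorem exists_sub_pow_mem_map_maximalIdeal (c : k →+* A)
    (hc : ∀ a, ∃ x, a - c x ∈ maximalIdeal A) (b : B) :
    ∃ x : k, ∃ n : ℕ, (b - algebraMap A B (c x)) ^ n ∈ (maximalIdeal A).map (algebraMap A B) := by
  have hbij : Function.Bijective ((residue A).comp c) :=
    ⟨RingHom.injective _, fun y => by
      obtain ⟨a, rfl⟩ := residue_surjective y
      obtain ⟨x, hx⟩ := hc a
      refine ⟨x, ?_⟩
      rw [RingHom.comp_apply, eq_comm, ← sub_eq_zero, ← map_sub, residue_eq_zero_iff]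
      exact hx⟩
  let e := RingEquiv.ofBijective _ hbij
  have hb : IsIntegral A b := Algebra.IsIntegral.isIntegral b
  have hm := minpoly.monic hb
  obtain ⟨x, hx⟩ := IsAlgClosed.exists_root
    ((minpoly A b).map ((e.symm : ResidueField A →+* k).comp (residue A))) (by
      rw [hm.degree_map]
      exact (minpoly.degree_pos hb).ne')
  have hy : residue A ((minpoly A b).eval (c x)) = 0 := by
    rw [← Polynomial.map_map, IsRoot, eval_map] at hx
    have h1 := congrArg e hx
    rw [eval₂_map, ← RingEquiv.coe_toRingHom, Polynomial.hom_eval₂, ← RingHom.comp_assoc] at h1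
    have h2 : ((e : k →+* ResidueField A).comp (e.symm : ResidueField A →+* k)) =
      RingHom.id _ := by ext; simp
    rw [h2, RingHom.id_comp, map_zero] at h1
    rw [← h1]
    exact (eval₂_at_apply (residue A) (c x)).symm
  set g := (minpoly A b).comp (X + C (c x)) with hg
  have hgm : g.Monic := hm.comp_X_add_C _
  have hgi : Irreducible g := by
    have := (MulEquiv.irreducible_iff (Polynomial.algEquivAevalXAddC (c x))
      (x := minpoly A b)).2 (minpoly.irreducible hb)
    simpa [hg, Polynomial.aeval_def, Polynomial.comp] using this
  have hg0 : g.coeff 0 ∈ maximalIdeal A := by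
    rw [← residue_eq_zero_iff, coeff_zero_eq_eval_zero, hg, eval_comp]
    simpa using hy
  have hgx := map_residue_eq_X_pow_of_irreducible hgm hgi hg0
  refine ⟨x, g.natDegree, ?_⟩
  have hroot : aeval (b - algebraMap A B (c x)) g = 0 := by
    simp [hg, aeval_comp]
  have hcoef : ∀ i, (g - X ^ g.natDegree).coeff i ∈ maximalIdeal A := by
    intro i
    rw [← Ideal.Quotient.eq_zero_iff_mem, ← Polynomial.coeff_map, Polynomial.map_sub, hgx]
    simp
  have h2 : aeval (b - algebraMap A B (c x)) (g - X ^ g.natDegree) ∈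
      (maximalIdeal A).map (algebraMap A B) := by
    rw [aeval_eq_sum_range]
    refine Ideal.sum_mem _ fun i _ => ?_
    rw [Algebra.smul_def]
    exact Ideal.mul_mem_right _ _ (Ideal.mem_map_of_mem _ (hcoef i))
  rw [map_sub, hroot, zero_sub, map_pow, aeval_X] at h2
  simpa using neg_mem h2

omit [IsDomain A] [IsAdicComplete (maximalIdeal A) A] [IsDomain B] in
theorem map_maximalIdeal_le_of_isMaximal (M : Ideal B) [M.IsMaximal] :
    (maximalIdeal A).map (algebraMap A B) ≤ M := by
  rw [Ideal.map_le_iff_le_comap]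
  have := Ideal.isMaximal_comap_of_isIntegral_of_isMaximal (R := A) M
  exact (eq_maximalIdeal this).ge

/-- A domain integral over a complete local integrally closed domain with algebraically closed
residue field is local. -/
theorem isLocalRing_of_isIntegral (c : k →+* A) (hc : ∀ a, ∃ x, a - c x ∈ maximalIdeal A) :
    IsLocalRing B := by
  -- For b in M the constant approximating b also lies in M, so it is zero; thus a power of b lies
  -- in the extension of the maximal ideal of A, which every N contains.
  have key : ∀ M N : Ideal B, M.IsMaximal → N.IsMaximal → M ≤ N := by
    intro M N hM hN b hb
    obtain ⟨x, n, hx⟩ := exists_sub_pow_mem_map_maximalIdeal c hc b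
    have h1 := hM.isPrime.mem_of_pow_mem _ (map_maximalIdeal_le_of_isMaximal M hx)
    have h2 : algebraMap A B (c x) ∈ M := by simpa using sub_mem hb h1
    have hx0 : x = 0 := by
      by_contra h0
      exact hM.ne_top (Ideal.eq_top_of_isUnit_mem _ h2
        (((isUnit_iff_ne_zero.2 h0).map c).map (algebraMap A B)))
    have h3 := hN.isPrime.mem_of_pow_mem _ (map_maximalIdeal_le_of_isMaximal N hx)
    simpa [hx0] using h3
  obtain ⟨M, hM⟩ := Ideal.exists_maximal B
  exact IsLocalRing.of_unique_max_ideal ⟨M, hM, fun N hN =>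
    le_antisymm (key _ _ hN hM) (key _ _ hM hN)⟩

theorem exists_sub_mem_maximalIdeal [IsLocalRing B] (c : k →+* A)
    (hc : ∀ a, ∃ x, a - c x ∈ maximalIdeal A) (b : B) :
    ∃ x : k, b - algebraMap A B (c x) ∈ maximalIdeal B := by
  obtain ⟨x, n, hx⟩ := exists_sub_pow_mem_map_maximalIdeal c hc b
  exact ⟨x, (maximalIdeal.isMaximal B).isPrime.mem_of_pow_mem _
    (map_maximalIdeal_le_of_isMaximal _ hx)⟩

end IntegralDomain

/-! ### The ring of integers over k[[t]] is a discrete valuation ring -/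

section LaurentSeries

variable (k : Type*) [Field k]

instance : IsAdicComplete (IsLocalRing.maximalIdeal k⟦X⟧) k⟦X⟧ := by
  rw [PowerSeries.maximalIdeal_eq_span_X]; infer_instance

theorem PowerSeries.exists_sub_C_mem_maximalIdeal (a : k⟦X⟧) :
    ∃ x, a - PowerSeries.C x ∈ IsLocalRing.maximalIdeal k⟦X⟧ := by
  refine ⟨PowerSeries.constantCoeff a, ?_⟩
  rw [PowerSeries.maximalIdeal_eq_span_X, Ideal.mem_span_singleton, PowerSeries.X_dvd_iff]
  simp

variable (L : Type*) [Field L] [Algebra k⸨X⸩ L] [Algebra k⟦X⟧ L] [IsScalarTower k⟦X⟧ k⸨X⸩ L]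

theorem algebraMap_powerSeries_injective : Function.Injective (algebraMap k⟦X⟧ L) := by
  rw [IsScalarTower.algebraMap_eq k⟦X⟧ k⸨X⸩ L, RingHom.coe_comp]
  exact (RingHom.injective (algebraMap k⸨X⸩ L)).comp (IsFractionRing.injective k⟦X⟧ k⸨X⸩)

theorem algebraMap_integralClosure_injective :
    Function.Injective (algebraMap k⟦X⟧ (integralClosure k⟦X⟧ L)) := by
  have := algebraMap_powerSeries_injective k L
  rw [IsScalarTower.algebraMap_eq k⟦X⟧ (integralClosure k⟦X⟧ L) L, RingHom.coe_comp] at this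
  exact Function.Injective.of_comp this

variable [IsAlgClosed k]

instance isLocalRing_integralClosure : IsLocalRing (integralClosure k⟦X⟧ L) :=
  isLocalRing_of_isIntegral (PowerSeries.C (R := k)) (PowerSeries.exists_sub_C_mem_maximalIdeal k)

variable [FiniteDimensional k⸨X⸩ L] [Algebra.IsSeparable k⸨X⸩ L]

instance isDiscreteValuationRing_integralClosure :
    IsDiscreteValuationRing (integralClosure k⟦X⟧ L) := by
  have h1 : IsDedekindDomain (integralClosure k⟦X⟧ L) :=
    integralClosure.isDedekindDomain k⟦X⟧ k⸨X⸩ L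
  have h2 : ¬ IsField (integralClosure k⟦X⟧ L) := fun h =>
    IsDiscreteValuationRing.not_isField k⟦X⟧ <|
      (Algebra.IsIntegral.isField_iff_isField (algebraMap_integralClosure_injective k L)).2 h
  exact ((IsDiscreteValuationRing.TFAE (integralClosure k⟦X⟧ L) h2).out 2 0).1 h1

end LaurentSeries
end

noncomputable section

/-! ### Ramification groups of a totally ramified action on a discrete valuation ring -/

open IsLocalRing

/-- A faithful action of `G` on a discrete valuation ring `B` that is trivial on the residue field
and for which the displacement of any element is controlled by that of the uniformizer `ϖ`. -/
structure IsTotallyRamifiedAction (G : Type*) [Group G] {B : Type*} [CommRing B]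
    [MulSemiringAction G B] (ϖ : B) : Prop where
  irreducible : Irreducible ϖ
  dvd_smul_sub : ∀ (g : G) (b : B), ϖ ∣ g • b - b
  smul_uniformizer_sub_dvd : ∀ (g : G) (b : B), g • ϖ - ϖ ∣ g • b - b
  faithful : ∀ g : G, (∀ b : B, g • b = b) → g = 1

/-- Multiplication by c permutes the non-zero elements of S; compare their product before and after.
-/
theorem pow_card_sub_one_eq_one_of_mul_mem {κ : Type*} [Field κ] (S : Finset κ) (h0 : (0 : κ) ∈ S)
    {c : κ} (hc : c ≠ 0) (h : ∀ x ∈ S, c * x ∈ S) : c ^ (S.card - 1) = 1 := by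
  classical
  have hinj : Function.Injective (fun x : κ => c * x) := mul_right_injective₀ hc
  have himg : (S.erase 0).image (fun x => c * x) = S.erase 0 := by
    refine Finset.eq_of_subset_of_card_le ?_ (Finset.card_image_of_injective _ hinj).ge
    intro y hy
    obtain ⟨x, hx, rfl⟩ := Finset.mem_image.1 hy
    rw [Finset.mem_erase] at hx ⊢
    exact ⟨mul_ne_zero hc hx.1, h x hx.2⟩
  have h1 : ∏ x ∈ S.erase 0, x = c ^ (S.card - 1) * ∏ x ∈ S.erase 0, x := by
    conv_lhs => rw [← himg, Finset.prod_image hinj.injOn, Finset.prod_mul_distrib,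
      Finset.prod_const, Finset.card_erase_of_mem h0]
  have h2 : ∏ x ∈ S.erase 0, x ≠ 0 :=
    Finset.prod_ne_zero_iff.2 fun x hx => (Finset.mem_erase.1 hx).1
  exact (mul_right_cancel₀ h2 (by rw [one_mul]; exact h1)).symm

namespace IsTotallyRamifiedAction

variable {G : Type*} [Group G] {B : Type*} [CommRing B] [MulSemiringAction G B] {ϖ : B}

variable (G ϖ) in
/-- The `j`-th ramification group, in the lower numbering. -/
def ram (j : ℕ) : Subgroup G := (Ideal.span {ϖ ^ (j + 1)}).inertia G

theorem mem_ram_iff_forall {j : ℕ} {g : G} : g ∈ ram G ϖ j ↔ ∀ b : B, ϖ ^ (j + 1) ∣ g • b - b := by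
  simp [ram, AddSubgroup.mem_inertia, Ideal.mem_span_singleton]

theorem ram_antitone : Antitone (ram G ϖ) := fun i j hij g hg => by
  rw [mem_ram_iff_forall] at hg ⊢
  exact fun b => (pow_dvd_pow ϖ (by omega)).trans (hg b)

variable (T : IsTotallyRamifiedAction G ϖ)
include T

theorem mem_ram {j : ℕ} {g : G} : g ∈ ram G ϖ j ↔ ϖ ^ (j + 1) ∣ g • ϖ - ϖ :=
  mem_ram_iff_forall.trans ⟨fun h => h ϖ, fun h b => h.trans (T.smul_uniformizer_sub_dvd g b)⟩

theorem ram_zero : ram G ϖ 0 = ⊤ := by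
  ext g
  simpa using T.mem_ram.2 (by simpa using T.dvd_smul_sub g ϖ)

theorem exists_smul_eq (g : G) : ∃ u : B, g • ϖ = u * ϖ := by
  obtain ⟨w, hw⟩ := T.dvd_smul_sub g ϖ
  exact ⟨1 + w, by linear_combination hw⟩

theorem pow_dvd_smul {n : ℕ} {b : B} (g : G) (h : ϖ ^ n ∣ b) : ϖ ^ n ∣ g • b := by
  obtain ⟨u, hu⟩ := T.exists_smul_eq g
  obtain ⟨c, rfl⟩ := h
  rw [smul_mul', smul_pow', hu, mul_pow, mul_comm (u ^ n), mul_assoc]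
  exact dvd_mul_right _ _

theorem ram_normal (j : ℕ) : (ram G ϖ j).Normal := ⟨fun g hg s => by
  rw [mem_ram_iff_forall] at hg ⊢
  intro b
  have := T.pow_dvd_smul s (hg (s⁻¹ • b))
  rwa [smul_sub, smul_inv_smul, smul_smul, smul_smul] at this⟩

/-- The ratio `g ϖ / ϖ`. -/
def ratio (g : G) : B := (T.exists_smul_eq g).choose

theorem smul_uniformizer (g : G) : g • ϖ = T.ratio g * ϖ := (T.exists_smul_eq g).choose_spec

theorem exists_smul_eq_add {j : ℕ} (g : ram G ϖ j) : ∃ a : B, (g : G) • ϖ = ϖ + ϖ ^ (j + 1) * a := by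
  obtain ⟨a, ha⟩ := T.mem_ram.1 g.2
  exact ⟨a, by linear_combination ha⟩

/-- The leading coefficient of `g ϖ - ϖ` for `g` in the `j`-th ramification group. -/
def leading {j : ℕ} (g : ram G ϖ j) : B := (T.exists_smul_eq_add g).choose

theorem smul_uniformizer_eq_add {j : ℕ} (g : ram G ϖ j) :
    (g : G) • ϖ = ϖ + ϖ ^ (j + 1) * T.leading g := (T.exists_smul_eq_add g).choose_spec

variable [IsDomain B]

/-- The ratio is a cocycle; it becomes a character modulo ϖ because G acts trivially on the residue
field. -/
theorem ratio_mul (g h : G) : T.ratio (g * h) = g • T.ratio h * T.ratio g := by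
  refine mul_right_cancel₀ T.irreducible.ne_zero ?_
  rw [← T.smul_uniformizer, mul_smul, T.smul_uniformizer h, smul_mul', T.smul_uniformizer g]
  ring

theorem ratio_one : T.ratio 1 = 1 := by
  refine mul_right_cancel₀ T.irreducible.ne_zero ?_
  rw [← T.smul_uniformizer, one_smul, one_mul]

variable [IsDiscreteValuationRing B]

theorem residue_eq_zero_iff_dvd {b : B} : residue B b = 0 ↔ ϖ ∣ b := by
  rw [residue_eq_zero_iff, T.irreducible.maximalIdeal_eq, Ideal.mem_span_singleton]

theorem residue_smul (g : G) (b : B) : residue B (g • b) = residue B b := by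
  rw [← sub_eq_zero, ← map_sub, T.residue_eq_zero_iff_dvd]
  exact T.dvd_smul_sub g b

/-- The tame character. -/
def tame : G →* (ResidueField B)ˣ := MonoidHom.toHomUnits
  { toFun := fun g => residue B (T.ratio g)
    map_one' := by rw [T.ratio_one, map_one]
    map_mul' := fun g h => by rw [T.ratio_mul, map_mul, T.residue_smul, mul_comm] }

theorem coe_tame (g : G) : (T.tame g : ResidueField B) = residue B (T.ratio g) := rfl

theorem ker_tame : T.tame.ker = ram G ϖ 1 := by
  ext g
  rw [MonoidHom.mem_ker, Units.ext_iff, coe_tame, Units.val_one, ← map_one (residue B),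
    ← sub_eq_zero, ← map_sub, T.residue_eq_zero_iff_dvd, T.mem_ram, T.smul_uniformizer]
  rw [show T.ratio g * ϖ - ϖ = (T.ratio g - 1) * ϖ by ring, pow_succ, pow_one]
  exact (mul_dvd_mul_iff_right T.irreducible.ne_zero).symm

omit [IsDiscreteValuationRing B] in
theorem leading_unique {j : ℕ} (g : ram G ϖ j) {a : B} (ha : (g : G) • ϖ = ϖ + ϖ ^ (j + 1) * a) :
    a = T.leading g := by
  refine mul_left_cancel₀ (pow_ne_zero (j + 1) T.irreducible.ne_zero) ?_
  linear_combination T.smul_uniformizer_eq_add g - ha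

/-- The wild character of `G_j` for `j = i + 1 ≥ 1`. -/
def wild (i : ℕ) : ram G ϖ (i + 1) →* Multiplicative (ResidueField B) where
  toFun g := Multiplicative.ofAdd (residue B (T.leading g))
  map_one' := by
    rw [← T.leading_unique (a := 0) 1 (by simp), map_zero, ofAdd_zero]
  map_mul' g h := by
    rw [← ofAdd_add, ← map_add]
    congr 1
    have hg := T.smul_uniformizer_eq_add g
    have hh := T.smul_uniformizer_eq_add h
    obtain ⟨w, hw⟩ := T.dvd_smul_sub (g : G) (T.leading h)
    have hw' : (g : G) • T.leading h = T.leading h + ϖ * w := by linear_combination hw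
    -- This gives (gϖ)^(i+2) = ϖ^(i+2)(1 + ϖy). So g changes the leading term of hϖ - ϖ only to
    -- higher order, and leading coefficients add modulo ϖ. The index i + 1 ≥ 1 is essential.
    have hd : ϖ ∣ (1 + ϖ ^ (i + 1) * T.leading g) ^ (i + 1 + 1) - 1 ^ (i + 1 + 1) := by
      refine Dvd.dvd.trans ?_ (sub_dvd_pow_sub_pow _ _ _)
      exact ⟨ϖ ^ i * T.leading g, by ring⟩
    obtain ⟨y, hy⟩ := hd
    rw [one_pow] at hy
    have hpow : ((g : G) • ϖ) ^ (i + 1 + 1) = ϖ ^ (i + 1 + 1) * (1 + ϖ * y) := by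
      rw [hg, show ϖ + ϖ ^ (i + 1 + 1) * T.leading g = ϖ * (1 + ϖ ^ (i + 1) * T.leading g) by ring,
        mul_pow]
      linear_combination ϖ ^ (i + 1 + 1) * hy
    have hgh : ((g * h : ram G ϖ (i + 1)) : G) • ϖ = ϖ + ϖ ^ (i + 1 + 1) *
        (T.leading g + (1 + ϖ * y) * (T.leading h + ϖ * w)) := by
      rw [Subgroup.coe_mul, mul_smul, hh, smul_add, smul_mul', smul_pow', hpow, hw', hg]
      ring
    rw [← T.leading_unique (g * h) hgh, ← sub_eq_zero, ← map_sub, T.residue_eq_zero_iff_dvd]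
    exact ⟨w + y * (T.leading h + ϖ * w), by ring⟩

theorem wild_eq_one_iff (i : ℕ) (g : ram G ϖ (i + 1)) :
    T.wild i g = 1 ↔ (g : G) ∈ ram G ϖ (i + 2) := by
  rw [T.mem_ram, T.smul_uniformizer_eq_add, add_sub_cancel_left, pow_succ ϖ (i + 2),
    mul_dvd_mul_iff_left (pow_ne_zero _ T.irreducible.ne_zero), ← T.residue_eq_zero_iff_dvd]
  exact ofAdd_eq_one

/-- Conjugation by `s` on `G_{i + 1}`. -/
def conj (s : G) (i : ℕ) : MulAut (ram G ϖ i) :=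
  haveI := T.ram_normal i
  MulAut.conjNormal s

omit [IsDomain B] [IsDiscreteValuationRing B] in
theorem coe_conj (s : G) (i : ℕ) (g : ram G ϖ i) : (T.conj s i g : G) = s * g * s⁻¹ :=
  haveI := T.ram_normal i
  MulAut.conjNormal_apply s g

/-- Compute s(gϖ) = (sgs⁻¹)(sϖ) in two ways with sϖ = uϖ: the leading coefficients satisfy u ·
leading(sgs⁻¹) ≡ u^(i+2) · leading(g) modulo ϖ. -/
theorem toAdd_wild_conj (s : G) (i : ℕ) (g : ram G ϖ (i + 1)) :
    (T.wild i (T.conj s (i + 1) g)).toAdd =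
      (T.tame s : ResidueField B) ^ (i + 1) * (T.wild i g).toAdd := by
  have hs := T.smul_uniformizer s
  have hg := T.smul_uniformizer_eq_add g
  have hg' := T.smul_uniformizer_eq_add (T.conj s (i + 1) g)
  obtain ⟨w, hw⟩ := mem_ram_iff_forall.1 (T.conj s (i + 1) g).2 (T.ratio s)
  have h1 : (T.conj s (i + 1) g : G) • s • ϖ = s • (g : G) • ϖ := by
    rw [T.coe_conj, smul_smul, smul_smul, inv_mul_cancel_right]
  rw [hs, hg, smul_mul', hg', smul_add, smul_mul', smul_pow', hs] at h1
  have h2 : T.ratio s * T.leading (T.conj s (i + 1) g) + ϖ * (w + ϖ ^ (i + 1) * w *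
      T.leading (T.conj s (i + 1) g)) = T.ratio s ^ (i + 2) * s • T.leading g := by
    refine mul_left_cancel₀ (pow_ne_zero (i + 1 + 1) T.irreducible.ne_zero) ?_
    linear_combination h1 - (ϖ + ϖ ^ (i + 1 + 1) * T.leading (T.conj s (i + 1) g)) * hw
  have h3 := congrArg (residue B) h2
  have hϖ : residue B ϖ = 0 := T.residue_eq_zero_iff_dvd.2 dvd_rfl
  rw [map_add, map_mul, map_mul _ ϖ, hϖ, zero_mul, add_zero, map_mul, map_pow, T.residue_smul] at h3
  refine mul_left_cancel₀ (T.tame s).ne_zero ?_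
  rw [← mul_assoc, ← pow_succ']
  exact h3

/-- The wild character embeds G_{i+1}/G_{i+2} in a commutative group. -/
theorem commutator_mem_ram {i : ℕ} {g h : G} (hg : g ∈ ram G ϖ (i + 1)) (hh : h ∈ ram G ϖ (i + 1)) :
    g * h * g⁻¹ * h⁻¹ ∈ ram G ϖ (i + 2) := by
  have := (T.wild_eq_one_iff i (⟨g, hg⟩ * ⟨h, hh⟩ * ⟨g, hg⟩⁻¹ * ⟨h, hh⟩⁻¹)).1 (by
    simp only [map_mul, map_inv]
    rw [mul_comm (T.wild i ⟨g, hg⟩), mul_inv_cancel_right, mul_inv_cancel])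
  simpa using this

theorem pow_char_mem_ram {p : ℕ} (hp : (p : ResidueField B) = 0) {i : ℕ} {g : G}
    (hg : g ∈ ram G ϖ (i + 1)) : g ^ p ∈ ram G ϖ (i + 2) := by
  have := (T.wild_eq_one_iff i (⟨g, hg⟩ ^ p)).1 (by
    rw [map_pow, ← toAdd_eq_zero, toAdd_pow, nsmul_eq_mul, hp, zero_mul])
  simpa using this

theorem exists_ram_eq_bot [Finite G] : ∃ N, ram G ϖ N = ⊥ := by
  have h1 : ∀ g : G, g ≠ 1 → ∃ N, ∀ n ≥ N, g ∉ ram G ϖ n := by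
    intro g hg
    by_contra! h
    refine hg (T.faithful g fun b => ?_)
    rw [← sub_eq_zero]
    by_contra hb
    obtain ⟨n, hn⟩ := FiniteMultiplicity.of_not_isUnit T.irreducible.not_isUnit hb
    obtain ⟨m, hm, hgm⟩ := h n
    exact hn ((pow_dvd_pow ϖ (by omega)).trans (mem_ram_iff_forall.1 hgm b))
  choose! N hN using h1
  obtain ⟨M, hM⟩ := (Set.finite_range N).bddAbove
  refine ⟨M, (Subgroup.eq_bot_iff_forall _).2 fun g hg => ?_⟩
  by_contra hne
  exact hN g hne M (hM ⟨g, rfl⟩) hg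

/-- Each p-th power descends one step of the filtration, which reaches the trivial group. -/
theorem isPGroup_ram_one [Finite G] {p : ℕ} (hp : (p : ResidueField B) = 0) :
    IsPGroup p (ram G ϖ 1) := by
  obtain ⟨N, hN⟩ := T.exists_ram_eq_bot
  intro g
  refine ⟨N, ?_⟩
  have : ∀ n, (g : G) ^ p ^ n ∈ ram G ϖ (n + 1) := by
    intro n
    induction n with
    | zero => simp
    | succ n ih => rw [pow_succ, pow_mul]; exact T.pow_char_mem_ram hp ih
  have h2 := ram_antitone (Nat.le_succ N) (this N)
  rw [hN, Subgroup.mem_bot] at h2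
  exact Subtype.ext (by simpa using h2)

/-! ### Congruences between orders of ramification groups -/

theorem card_ram_eq (i : ℕ) : Nat.card (ram G ϖ (i + 1)) =
    Nat.card (T.wild i).range * Nat.card (ram G ϖ (i + 2)) := by
  have hk : (T.wild i).ker = (ram G ϖ (i + 2)).subgroupOf (ram G ϖ (i + 1)) := by
    ext g
    rw [MonoidHom.mem_ker, T.wild_eq_one_iff, Subgroup.mem_subgroupOf]
  rw [← Subgroup.index_mul_card (T.wild i).ker, Subgroup.index_ker, hk,
    Nat.card_congr (Subgroup.subgroupOfEquivOfLe (ram_antitone (Nat.le_succ (i + 1)))).toEquiv]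

variable [Finite G]

instance finite_range_wild (i : ℕ) : Finite (T.wild i).range := Finite.Set.finite_range (T.wild i)

instance finite_range_tame : Finite T.tame.range := Finite.Set.finite_range T.tame

/-- The image of the wild character is a finite subset of the residue field stable under
multiplication by θ(s)^(i+1), by the conjugation formula. -/
theorem tame_pow_eq_one (s : G) (i : ℕ) :
    T.tame s ^ ((i + 1) * (Nat.card (T.wild i).range - 1)) = 1 := by
  classical
  have := Fintype.ofFinite (ram G ϖ (i + 1))
  have h1 := pow_card_sub_one_eq_one_of_mul_mem
    (Finset.univ.image fun g : ram G ϖ (i + 1) => (T.wild i g).toAdd)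
    (Finset.mem_image.2 ⟨1, Finset.mem_univ _, by simp⟩)
    (c := (T.tame s : ResidueField B) ^ (i + 1)) (pow_ne_zero _ (T.tame s).ne_zero) (by
      intro x hx
      obtain ⟨g, -, rfl⟩ := Finset.mem_image.1 hx
      exact Finset.mem_image.2 ⟨T.conj s (i + 1) g, Finset.mem_univ _, T.toAdd_wild_conj s i g⟩)
  have h2 : (Finset.univ.image fun g : ram G ϖ (i + 1) => (T.wild i g).toAdd).card =
      Nat.card (T.wild i).range := by
    rw [← Set.toFinset_range, ← Nat.card_eq_card_toFinset]
    exact Nat.card_congr (Equiv.subtypeEquiv Multiplicative.ofAdd fun x => Iff.rfl)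
  rw [h2, ← pow_mul] at h1
  exact Units.ext (by simpa using h1)

/-- In the induction, replacing m|G_m| + |G_{m+1}| by (m+1)|G_{m+1}| costs m(r - 1)|G_{m+1}| with r
= |G_m/G_{m+1}|, and the order of θ(s) divides m(r - 1). -/
theorem orderOf_tame_dvd (s : G) (m : ℕ) : ∃ M, ∑ j ∈ Finset.Icc 1 m, Nat.card (ram G ϖ j) =
    m * Nat.card (ram G ϖ m) + orderOf (T.tame s) * M := by
  induction m with
  | zero => exact ⟨0, by simp⟩
  | succ m ih =>
    obtain ⟨M, hM⟩ := ih
    rw [Finset.sum_Icc_succ_top (by omega), hM]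
    rcases m with _ | i
    · exact ⟨M, by ring⟩
    · obtain ⟨c, hc⟩ := orderOf_dvd_of_pow_eq_one (T.tame_pow_eq_one s i)
      have hpos : 0 < Nat.card (T.wild i).range := Nat.card_pos
      refine ⟨M + c * Nat.card (ram G ϖ (i + 2)), ?_⟩
      rw [T.card_ram_eq i]
      obtain ⟨r, hr⟩ : ∃ r, Nat.card (T.wild i).range = r + 1 := ⟨_, (Nat.succ_pred hpos.ne').symm⟩
      rw [hr] at hc ⊢
      rw [Nat.add_sub_cancel] at hc
      linear_combination (Nat.card (ram G ϖ (i + 2))) * hc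

/-- A finite group of units of a field is cyclic, and the tame character has kernel G_1. -/
theorem exists_orderOf_tame : ∃ s : G, orderOf (T.tame s) * Nat.card (ram G ϖ 1) = Nat.card G := by
  obtain ⟨⟨_, s, rfl⟩, hs⟩ := IsCyclic.exists_generator (α := T.tame.range)
  refine ⟨s, ?_⟩
  rw [← Subgroup.index_mul_card T.tame.ker, Subgroup.index_ker, T.ker_tame]
  congr 1
  have h := orderOf_eq_card_of_forall_mem_zpowers hs
  rw [← h, ← Subgroup.orderOf_coe]

/-- If `(|G_1| + ⋯ + |G_{i+1}|) / |G_0| = n / d` with `d` prime to `p n`, then some `s : G` acts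
on `G_{i+1} / G_{i+2}` so that distinct powers among the first `d` ones differ by a bijection. -/
theorem exists_conj_surjective {p : ℕ} [Fact p.Prime] (hp : (p : ResidueField B) = 0) {n d i : ℕ}
    (hnd : n.Coprime d) (hpd : p.Coprime d)
    (h : d * ∑ j ∈ Finset.Icc 1 (i + 1), Nat.card (ram G ϖ j) = n * Nat.card (ram G ϖ 0)) :
    ∃ s : G, ∀ a < d, ∀ b < d, a ≠ b → ∀ q : ram G ϖ (i + 1), ∃ r : ram G ϖ (i + 1),
      ((T.conj (s ^ a) (i + 1) r * (T.conj (s ^ b) (i + 1) r)⁻¹ * q⁻¹ : ram G ϖ (i + 1)) : G) ∈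
        ram G ϖ (i + 2) := by
  obtain ⟨s, hs⟩ := T.exists_orderOf_tame
  refine ⟨s, ?_⟩
  have key : ∀ a < d, ∀ b < a, T.tame s ^ ((i + 1) * a) ≠ T.tame s ^ ((i + 1) * b) := by
    intro a ha b hb hab
    have h1 : T.tame s ^ ((i + 1) * (a - b)) = 1 := by
      rw [Nat.mul_sub, pow_sub _ (Nat.mul_le_mul_left _ hb.le), hab, mul_inv_cancel]
    obtain ⟨c, hc⟩ := orderOf_dvd_of_pow_eq_one h1
    obtain ⟨M, hM⟩ := T.orderOf_tame_dvd s (i + 1)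
    rw [T.ram_zero, Subgroup.card_top, ← hs, hM] at h
    have hpos : 0 < orderOf (T.tame s) :=
      orderOf_pos_iff.2 (T.tame.isOfFinOrder (isOfFinOrder_of_finite s))
    obtain ⟨l, hl⟩ := (IsPGroup.iff_card).1 (T.isPGroup_ram_one hp)
    -- The order of θ(s) divides (i+1)(a-b), so it can be cancelled from a - b times the hypothesis
    -- on the sum of orders.
    have h2 : d * (c * Nat.card (ram G ϖ (i + 1)) + (a - b) * M) = n * p ^ l * (a - b) := by
      rw [← hl]
      refine Nat.eq_of_mul_eq_mul_left hpos ?_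
      linear_combination (a - b) * h - d * Nat.card (ram G ϖ (i + 1)) * hc
    have h3 : d ∣ n * p ^ l * (a - b) := ⟨_, h2.symm⟩
    have h4 : d ∣ a - b := Nat.Coprime.dvd_of_dvd_mul_left
      (Nat.Coprime.mul_right hnd.symm (Nat.Coprime.pow_right l hpd.symm)) h3
    exact absurd (Nat.le_of_dvd (by omega) h4) (by omega)
  intro a ha b hb hab q
  have hne : (T.tame s : ResidueField B) ^ ((i + 1) * a) - (T.tame s) ^ ((i + 1) * b) ≠ 0 := by
    rw [sub_ne_zero]
    intro he
    have he' : T.tame s ^ ((i + 1) * a) = T.tame s ^ ((i + 1) * b) := Units.ext (by simpa using he)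
    rcases lt_or_gt_of_ne hab with h' | h'
    · exact key b hb a h' he'.symm
    · exact key a ha b h' he'
  have hF : ∀ r : ram G ϖ (i + 1),
      (T.wild i (T.conj (s ^ a) (i + 1) r * (T.conj (s ^ b) (i + 1) r)⁻¹)).toAdd =
      ((T.tame s : ResidueField B) ^ ((i + 1) * a) - (T.tame s) ^ ((i + 1) * b)) *
        (T.wild i r).toAdd := by
    intro r
    rw [map_mul, map_inv, toAdd_mul, toAdd_inv, T.toAdd_wild_conj, T.toAdd_wild_conj, map_pow,
      map_pow]
    push_cast
    ring
  -- On wild characters this is multiplication by ζ^a - ζ^b, injective on a finite set, hence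
  -- surjective.
  let F : (T.wild i).range → (T.wild i).range := fun x =>
    ⟨T.wild i (T.conj (s ^ a) (i + 1) x.2.choose * (T.conj (s ^ b) (i + 1) x.2.choose)⁻¹), _, rfl⟩
  have hFinj : Function.Injective F := by
    intro x y hxy
    have h1 := congrArg (fun z : (T.wild i).range => (z : Multiplicative (ResidueField B)).toAdd) hxy
    simp only [F] at h1
    rw [hF, hF, x.2.choose_spec, y.2.choose_spec] at h1
    exact Subtype.ext (Multiplicative.toAdd.injective (mul_left_cancel₀ hne h1))
  obtain ⟨x, hx⟩ := Finite.surjective_of_injective hFinj ⟨T.wild i q, q, rfl⟩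
  refine ⟨x.2.choose, ?_⟩
  rw [← T.wild_eq_one_iff, map_mul, map_inv, mul_inv_eq_one]
  exact congrArg Subtype.val hx

end IsTotallyRamifiedAction
end

noncomputable section

/-! ### Galois action on the ring of integers -/

open IsLocalRing
open IsDiscreteValuationRing hiding maximalIdeal

theorem IsDiscreteValuationRing.addVal_smul {G B : Type*} [Group G] [CommRing B] [IsDomain B]
    [IsDiscreteValuationRing B] [MulSemiringAction G B] (g : G) (b : B) :
    addVal B (g • b) = addVal B b := by
  rcases eq_or_ne b 0 with rfl | hb
  · rw [smul_zero]
  obtain ⟨ϖ, hϖ⟩ := exists_irreducible B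
  obtain ⟨n, u, hu⟩ := eq_unit_mul_pow_irreducible hb hϖ
  have hg : Irreducible (g • ϖ) :=
    (MulEquiv.irreducible_iff (MulSemiringAction.toRingEquiv G B g)).2 hϖ
  rw [addVal_def b u hϖ n hu]
  refine addVal_def _ (Units.map (MulSemiringAction.toRingHom G B g).toMonoidHom u) hg n ?_
  rw [hu, smul_mul', smul_pow']
  rfl

section LaurentSeries

variable {k : Type*} [Field k]
variable {L : Type*} [Field L] [Algebra k⸨X⸩ L] [Algebra k⟦X⟧ L] [IsScalarTower k⟦X⟧ k⸨X⸩ L]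

local notation "𝓑" => integralClosure k⟦X⟧ L

variable (k L) in
omit [Algebra k⸨X⸩ L] [IsScalarTower k⟦X⟧ k⸨X⸩ L] in
theorem dvd_algebraMap_of_mem_maximalIdeal {a : k⟦X⟧} (ha : a ∈ maximalIdeal k⟦X⟧) :
    algebraMap k⟦X⟧ 𝓑 PowerSeries.X ∣ algebraMap k⟦X⟧ 𝓑 a := by
  rw [PowerSeries.maximalIdeal_eq_span_X, Ideal.mem_span_singleton] at ha
  exact map_dvd _ ha

variable [IsAlgClosed k]

omit [Algebra k⸨X⸩ L] [IsScalarTower k⟦X⟧ k⸨X⸩ L] in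
theorem exists_sub_C_mem_maximalIdeal (b : 𝓑) :
    ∃ x : k, b - algebraMap k⟦X⟧ 𝓑 (PowerSeries.C x) ∈ maximalIdeal 𝓑 :=
  exists_sub_mem_maximalIdeal (PowerSeries.C (R := k))
    (PowerSeries.exists_sub_C_mem_maximalIdeal k) b

variable [FiniteDimensional k⸨X⸩ L]

section Separable

variable [Algebra.IsSeparable k⸨X⸩ L]

/-- A truncated ϖ-adic expansion with coefficients in k, which exists because k is the residue
field. -/
theorem exists_sub_pow_mul_mem_span {ϖ : 𝓑} (hϖ : Irreducible ϖ) (N : ℕ) (b : 𝓑) :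
    ∃ a ∈ Submodule.span k⟦X⟧ (Set.range fun j : Fin N => ϖ ^ (j : ℕ)), ϖ ^ N ∣ b - a := by
  induction N with
  | zero => exact ⟨0, zero_mem _, by simp⟩
  | succ N ih =>
    obtain ⟨a, ha, c, hc⟩ := ih
    obtain ⟨x, hx⟩ := exists_sub_C_mem_maximalIdeal c
    rw [hϖ.maximalIdeal_eq, Ideal.mem_span_singleton] at hx
    obtain ⟨y, hy⟩ := hx
    refine ⟨a + PowerSeries.C x • ϖ ^ N, add_mem ?_ ?_, y, ?_⟩
    · refine Submodule.span_mono ?_ ha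
      rintro _ ⟨j, rfl⟩
      exact ⟨j.castSucc, rfl⟩
    · exact Submodule.smul_mem _ _ (Submodule.subset_span ⟨Fin.last N, rfl⟩)
    · rw [Algebra.smul_def]
      linear_combination hc + ϖ ^ N * hy

variable (k L) in
omit [IsAlgClosed k] in
theorem moduleFinite_integralClosure : Module.Finite k⟦X⟧ 𝓑 :=
  IsIntegralClosure.finite k⟦X⟧ k⸨X⸩ L 𝓑

/-- Nakayama's lemma: the expansion up to ϖ^e shows that these powers span modulo X. -/
theorem span_pow_uniformizer_eq_top {ϖ : 𝓑} (hϖ : Irreducible ϖ) {e : ℕ}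
    (he : algebraMap k⟦X⟧ 𝓑 PowerSeries.X ∣ ϖ ^ e) :
    Submodule.span k⟦X⟧ (Set.range fun j : Fin e => ϖ ^ (j : ℕ)) = ⊤ := by
  have := moduleFinite_integralClosure k L
  refine top_le_iff.1 (Submodule.le_of_le_smul_of_le_jacobson_bot (I := maximalIdeal k⟦X⟧) (M := 𝓑)
    Module.Finite.fg_top (maximalIdeal_le_jacobson _) ?_)
  intro b _
  obtain ⟨a, ha, hd⟩ := exists_sub_pow_mul_mem_span hϖ e b
  obtain ⟨c, hc⟩ := he.trans hd
  have : b = a + (PowerSeries.X : k⟦X⟧) • c := by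
    rw [Algebra.smul_def]; linear_combination hc
  rw [this]
  refine Submodule.add_mem_sup ha (Submodule.smul_mem_smul ?_ trivial)
  rw [PowerSeries.maximalIdeal_eq_span_X]
  exact Ideal.mem_span_singleton_self _

omit [IsAlgClosed k] [FiniteDimensional k⸨X⸩ L] [Algebra.IsSeparable k⸨X⸩ L] in
theorem algebraMap_X_ne_zero : algebraMap k⟦X⟧ 𝓑 PowerSeries.X ≠ 0 := by
  rw [Ne, map_eq_zero_iff _ (algebraMap_integralClosure_injective k L)]
  exact PowerSeries.X_ne_zero

theorem adjoin_uniformizer_eq_top {ϖ : 𝓑} (hϖ : Irreducible ϖ) : Algebra.adjoin k⟦X⟧ {ϖ} = ⊤ := by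
  obtain ⟨e, u, hu⟩ := eq_unit_mul_pow_irreducible (algebraMap_X_ne_zero (k := k) (L := L)) hϖ
  have h := span_pow_uniformizer_eq_top hϖ (e := e) (by rw [hu]; simp)
  rw [← Algebra.toSubmodule_eq_top, ← top_le_iff, ← h, Submodule.span_le]
  rintro _ ⟨j, rfl⟩
  exact Subalgebra.pow_mem _ (Algebra.subset_adjoin (Set.mem_singleton ϖ)) _

theorem finrank_le_addVal_X : (Module.finrank k⸨X⸩ L : ℕ∞) ≤
    addVal 𝓑 (algebraMap k⟦X⟧ 𝓑 PowerSeries.X) := by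
  obtain ⟨ϖ, hϖ⟩ := exists_irreducible 𝓑
  obtain ⟨e, u, hu⟩ := eq_unit_mul_pow_irreducible (algebraMap_X_ne_zero (k := k) (L := L)) hϖ
  have h := span_pow_uniformizer_eq_top hϖ (e := e) (by rw [hu]; simp)
  rw [addVal_def _ u hϖ e hu]
  have : Module.IsTorsionFree k⟦X⟧ L :=
    (Module.isTorsionFree_iff_algebraMap_injective).2 (algebraMap_powerSeries_injective k L)
  rw [← IsIntegralClosure.rank k⟦X⟧ k⸨X⸩ L 𝓑, Nat.cast_le]
  simpa using finrank_le_of_span_eq_top h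
end Separable

variable [IsGalois k⸨X⸩ L]

omit [IsAlgClosed k] in
theorem exists_algebraMap_eq_of_forall_smul_eq {b : 𝓑} (hb : ∀ σ : Gal(L/k⸨X⸩), σ • b = b) :
    ∃ a, algebraMap k⟦X⟧ 𝓑 a = b := by
  obtain ⟨x, hx⟩ := (IsGalois.mem_range_algebraMap_iff_fixed (F := k⸨X⸩) (b : L)).2
    fun σ => congrArg Subtype.val (hb σ)
  have hxi : IsIntegral k⟦X⟧ x := by
    rw [← isIntegral_algebraMap_iff (B := L) (RingHom.injective _), hx]
    exact b.2
  obtain ⟨a, ha⟩ := IsIntegrallyClosed.isIntegral_iff.1 hxi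
  refine ⟨a, Subtype.ext ?_⟩
  rw [← hx, ← ha, ← IsScalarTower.algebraMap_apply]
  rfl

/-- Total ramification. The norm of a uniformizer has valuation the degree and is a non-unit of
k[[X]], hence divisible by X; the reverse bound counts the spanning powers of ϖ. -/
theorem addVal_X : addVal 𝓑 (algebraMap k⟦X⟧ 𝓑 PowerSeries.X) = Module.finrank k⸨X⸩ L := by
  refine le_antisymm ?_ finrank_le_addVal_X
  obtain ⟨ϖ, hϖ⟩ := exists_irreducible 𝓑
  have hfix : ∀ σ : Gal(L/k⸨X⸩), σ • ∏ τ : Gal(L/k⸨X⸩), τ • ϖ = ∏ τ : Gal(L/k⸨X⸩), τ • ϖ := by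
    intro σ
    rw [Finset.smul_prod']
    simp_rw [smul_smul]
    exact Fintype.prod_equiv (Equiv.mulLeft σ) _ _ fun τ => rfl
  obtain ⟨a, ha⟩ := exists_algebraMap_eq_of_forall_smul_eq hfix
  have hv : addVal 𝓑 (∏ τ : Gal(L/k⸨X⸩), τ • ϖ) = Module.finrank k⸨X⸩ L := by
    rw [← IsGalois.card_aut_eq_finrank k⸨X⸩ L, Nat.card_eq_fintype_card]
    have : ∀ s : Finset Gal(L/k⸨X⸩), addVal 𝓑 (∏ τ ∈ s, τ • ϖ) = s.card := by
      classical
      intro s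
      induction s using Finset.induction_on with
      | empty => simp
      | insert a s h ih =>
        rw [Finset.prod_insert h, addVal_mul, ih, addVal_smul, addVal_uniformizer hϖ,
          Finset.card_insert_of_notMem h]
        push_cast
        ring
    exact this Finset.univ
  rw [← hv, ← ha, addVal_le_iff_dvd]
  refine dvd_algebraMap_of_mem_maximalIdeal k L ?_
  rw [mem_maximalIdeal, mem_nonunits_iff]
  intro hu
  have h0 := (addVal_eq_zero_iff (R := 𝓑)).2 (hu.map (algebraMap k⟦X⟧ 𝓑))
  rw [ha, hv, Nat.cast_eq_zero] at h0
  exact Module.finrank_pos.ne' h0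

/-- Residues lift to constants, which the Galois group fixes; ϖ generates the ring over k[[X]]; and
the ring has fraction field L. -/
theorem isTotallyRamifiedAction {ϖ : 𝓑} (hϖ : Irreducible ϖ) :
    IsTotallyRamifiedAction Gal(L/k⸨X⸩) ϖ where
  irreducible := hϖ
  dvd_smul_sub g b := by
    obtain ⟨x, hx⟩ := exists_sub_C_mem_maximalIdeal b
    have h1 : g • (b - algebraMap k⟦X⟧ 𝓑 (PowerSeries.C x)) ∈ maximalIdeal 𝓑 := by
      rw [mem_maximalIdeal, mem_nonunits_iff, ← addVal_eq_zero_iff, addVal_smul, addVal_eq_zero_iff]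
      exact (mem_maximalIdeal _).1 hx
    rw [← Ideal.mem_span_singleton, ← hϖ.maximalIdeal_eq]
    have := sub_mem h1 hx
    rwa [smul_sub, smul_algebraMap, sub_sub_sub_cancel_right] at this
  smul_uniformizer_sub_dvd g b := by
    have hb : b ∈ Algebra.adjoin k⟦X⟧ {ϖ} := by rw [adjoin_uniformizer_eq_top hϖ]; trivial
    induction hb using Algebra.adjoin_induction with
    | mem x hx => rw [Set.mem_singleton_iff.1 hx]
    | algebraMap r => rw [smul_algebraMap, sub_self]; exact dvd_zero _
    | add x y _ _ hx hy => rw [smul_add, add_sub_add_comm]; exact dvd_add hx hy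
    | mul x y _ _ hx hy =>
      rw [smul_mul', show g • x * g • y - x * y = g • x * (g • y - y) + (g • x - x) * y by ring]
      exact dvd_add (hy.mul_left _) (hx.mul_right _)
  faithful g hg := by
    have := IsIntegralClosure.isFractionRing_of_finite_extension k⟦X⟧ k⸨X⸩ L 𝓑
    refine AlgEquiv.ext fun x => ?_
    obtain ⟨a, b, _, rfl⟩ := IsFractionRing.div_surjective 𝓑 x
    have h : ∀ b : 𝓑, g (algebraMap 𝓑 L b) = algebraMap 𝓑 L b := fun b => congrArg Subtype.val (hg b)
    rw [map_div₀, h, h]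
    rfl

theorem lowerRamificationGroup_eq_ram {ϖ : 𝓑} (hϖ : Irreducible ϖ) (m : ℕ) :
    lowerRamificationGroup k⟦X⟧ k⸨X⸩ L m = IsTotallyRamifiedAction.ram Gal(L/k⸨X⸩) ϖ m := by
  rw [lowerRamificationGroup, IsLocalRing.jacobson_eq_maximalIdeal _ bot_ne_top, hϖ.maximalIdeal_eq,
    Ideal.span_singleton_pow]
  rfl

end LaurentSeries
end

noncomputable section

/-! ### Herbrand's theorem -/

open IsLocalRing
open IsDiscreteValuationRing hiding maximalIdeal

namespace IsTotallyRamifiedAction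

/-- Serre's function `i_G`. -/
def displacement {G B : Type*} [Group G] [CommRing B] [IsDomain B] [IsDiscreteValuationRing B]
    [MulSemiringAction G B] (ϖ : B) (g : G) : ℕ∞ :=
  addVal B (g • ϖ - ϖ)

section Basic

variable {G B : Type*} [Group G] [CommRing B] [IsDomain B] [IsDiscreteValuationRing B]
  [MulSemiringAction G B] {ϖ : B}

theorem min_displacement_le_mul (g h : G) :
    min (displacement ϖ g) (displacement ϖ h) ≤ displacement ϖ (g * h) := by
  have : (g * h) • ϖ - ϖ = (g • ϖ - ϖ) + g • (h • ϖ - ϖ) := by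
    rw [mul_smul, smul_sub]; ring
  rw [displacement, displacement, displacement, this, ← addVal_smul g (h • ϖ - ϖ)]
  exact addVal_add

theorem displacement_inv (g : G) : displacement ϖ g⁻¹ = displacement ϖ g := by
  rw [displacement, displacement, ← addVal_smul g (g⁻¹ • ϖ - ϖ), smul_sub, smul_inv_smul,
    ← neg_sub, AddValuation.map_neg]

theorem mem_ram_iff_le_displacement (T : IsTotallyRamifiedAction G ϖ) {j : ℕ} {g : G} :
    g ∈ ram G ϖ j ↔ ((j + 1 : ℕ) : ℕ∞) ≤ displacement ϖ g := by
  rw [T.mem_ram, ← addVal_le_iff_dvd, T.irreducible.addVal_pow, displacement]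

theorem displacement_eq_top_iff (T : IsTotallyRamifiedAction G ϖ) {g : G} :
    displacement ϖ g = ⊤ ↔ g = 1 := by
  rw [displacement, addVal_eq_top_iff]
  constructor
  · intro h
    refine T.faithful g fun b => ?_
    have := T.smul_uniformizer_sub_dvd g b
    rwa [h, zero_dvd_iff, sub_eq_zero] at this
  · rintro rfl
    simp

theorem smul_uniformizer_injective (T : IsTotallyRamifiedAction G ϖ) :
    Function.Injective fun g : G => g • ϖ := by
  intro g h hgh
  have h1 : (h⁻¹ * g) • ϖ = ϖ := by
    rw [mul_smul]
    simp only at hgh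
    rw [hgh, inv_smul_smul]
  have := T.displacement_eq_top_iff.1 (show displacement ϖ (h⁻¹ * g) = ⊤ by
    rw [displacement, h1, sub_self, addVal_zero])
  rwa [inv_mul_eq_one, eq_comm] at this

end Basic

/-! ### Displacements in a quotient group -/

section Quotient

open Polynomial

variable {A G G' B B' : Type*} [CommRing A] [Group G] [Group G'] [CommRing B] [CommRing B']
  [IsDomain B'] [Algebra A B'] [MulSemiringAction G B] [MulSemiringAction G' B']
  [SMulCommClass G' A B'] {ϖ : B} {ϖ' : B'}

/-- Write b = P(ϖ'). The conjugates hϖ' are distinct roots of P - b, so the product of the X - hϖ'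
divides P - b; apply g to coefficients and evaluate at ϖ'. -/
theorem prod_dvd_map_smul_sub [IsDiscreteValuationRing B'] (T' : IsTotallyRamifiedAction G' ϖ')
    (hgen : Algebra.adjoin A {ϖ'} = ⊤) (H : Subgroup G') [Fintype H] {b : B'}
    (hb : ∀ h ∈ H, h • b = b) (g : G') :
    ∏ h : H, ((g * h) • ϖ' - ϖ') ∣ g • b - b := by
  obtain ⟨P, hP⟩ : ∃ P : A[X], aeval ϖ' P = b := by
    have : b ∈ Algebra.adjoin A {ϖ'} := by rw [hgen]; trivial
    rwa [Algebra.adjoin_singleton_eq_range_aeval] at this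
  have hroot : ∀ h : G', aeval (h • ϖ') P = h • b := by
    intro h
    rw [← hP]
    exact aeval_algHom_apply (MulSemiringAction.toAlgHom A B' h) ϖ' P
  set Q : B'[X] := P.map (algebraMap A B') - C b with hQ
  have hdvd : ∏ h : H, (X - C ((h : G') • ϖ')) ∣ Q := by
    by_cases hQ0 : Q = 0
    · rw [hQ0]; exact dvd_zero _
    · have := (Multiset.prod_X_sub_C_dvd_iff_le_roots hQ0
        (Multiset.map (fun h : H => (h : G') • ϖ') Finset.univ.val)).2 (by
          refine (Multiset.le_iff_subset (Multiset.Nodup.map (f := fun h : H => (h : G') • ϖ')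
            (T'.smul_uniformizer_injective.comp Subtype.val_injective) Finset.univ.nodup)).2 ?_
          intro x hx
          obtain ⟨h, -, rfl⟩ := Multiset.mem_map.1 hx
          rw [mem_roots hQ0, IsRoot, hQ, eval_sub, eval_C, eval_map_algebraMap]
          rw [hroot, hb _ h.2, sub_self])
      rw [Multiset.map_map] at this
      exact this
  have h2 : g • (∏ h : H, (X - C ((h : G') • ϖ'))) ∣ g • Q := by
    obtain ⟨R, hR⟩ := hdvd
    exact ⟨g • R, by rw [hR, smul_mul']⟩
  have h3 := map_dvd (evalRingHom ϖ') h2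
  have h4 : evalRingHom ϖ' (g • Q) = -(g • b - b) := by
    have : g • (P.map (algebraMap A B')) = P.map (algebraMap A B') := by
      rw [Polynomial.smul_eq_map, Polynomial.map_map]
      congr 1
      ext a
      exact smul_algebraMap g a
    rw [hQ, smul_sub, this, smul_C, coe_evalRingHom, eval_sub, eval_C, eval_map_algebraMap, hP]
    ring
  have h5 : evalRingHom ϖ' (g • (∏ h : H, (X - C ((h : G') • ϖ')))) =
      ∏ h : H, (-((g * h) • ϖ' - ϖ')) := by
    rw [Finset.smul_prod', map_prod]
    refine Finset.prod_congr rfl fun h _ => ?_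
    rw [smul_sub, smul_X, smul_C, coe_evalRingHom, eval_sub, eval_X, eval_C, smul_smul]
    ring
  rw [h4, h5, Finset.prod_neg, dvd_neg] at h3
  exact (dvd_mul_left _ _).trans h3

omit [IsDomain B'] in
-- The polynomial f with roots the conjugates of ϖ' under the kernel has coefficients from B, which
-- g moves by multiples of q(g)ϖ - ϖ. Evaluate gf - f at the root ϖ' of f.
theorem map_smul_sub_dvd_prod (T : IsTotallyRamifiedAction G ϖ) (q : G' →* G) (ι : B →+* B')
    (hι : ∀ g b, ι (q g • b) = g • ι b) [Fintype q.ker]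
    (hdesc : ∀ b' : B', (∀ h ∈ q.ker, h • b' = b') → ∃ b, ι b = b') (g : G') :
    ι (q g • ϖ - ϖ) ∣ ∏ h : q.ker, ((g * h) • ϖ' - ϖ') := by
  set f : B'[X] := ∏ h : q.ker, (X - C ((h : G') • ϖ')) with hf
  have hf' : f = MulSemiringAction.charpoly q.ker ϖ' := by
    rw [MulSemiringAction.charpoly_eq_prod_smul]
    refine Finset.prod_congr rfl fun h _ => ?_
    rw [smul_sub, smul_X, smul_C]
    rfl
  have hcoef : ∀ n, ι (q g • ϖ - ϖ) ∣ (g • f - f).coeff n := by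
    intro n
    obtain ⟨c, hc⟩ := hdesc (f.coeff n) fun h hh => by
      rw [hf']
      exact MulSemiringAction.smul_coeff_charpoly ϖ' n (⟨h, hh⟩ : q.ker)
    rw [coeff_sub, coeff_smul, ← hc, ← hι, ← map_sub]
    exact map_dvd ι (T.smul_uniformizer_sub_dvd _ _)
  have h1 : ι (q g • ϖ - ϖ) ∣ (g • f - f).eval ϖ' := by
    rw [eval_eq_sum_range]
    exact Finset.dvd_sum fun n _ => (hcoef n).mul_right _
  have h2 : f.eval ϖ' = 0 := by
    rw [hf, eval_prod]
    exact Finset.prod_eq_zero (Finset.mem_univ 1) (by simp)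
  have h3 : (g • f).eval ϖ' = ∏ h : q.ker, (-((g * h) • ϖ' - ϖ')) := by
    rw [hf, Finset.smul_prod', eval_prod]
    refine Finset.prod_congr rfl fun h _ => ?_
    rw [smul_sub, smul_X, smul_C, eval_sub, eval_X, eval_C, smul_smul]
    ring
  rw [eval_sub, h2, sub_zero, h3, Finset.prod_neg] at h1
  exact (isUnit_neg_one.pow _).dvd_mul_left.1 h1

variable [IsDomain B] [IsDiscreteValuationRing B] [IsDiscreteValuationRing B']

theorem card_ker_mul_displacement (T : IsTotallyRamifiedAction G ϖ)
    (T' : IsTotallyRamifiedAction G' ϖ') (hgen : Algebra.adjoin A {ϖ'} = ⊤)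
    (q : G' →* G) (ι : B →+* B') (hι : ∀ g b, ι (q g • b) = g • ι b) [Fintype q.ker]
    (hdesc : ∀ b' : B', (∀ h ∈ q.ker, h • b' = b') → ∃ b, ι b = b')
    (hval : ∀ b, addVal B' (ι b) = Nat.card q.ker * addVal B b) (g : G') :
    Nat.card q.ker * displacement ϖ (q g) = ∑ h : q.ker, displacement ϖ' (g * h) := by
  have h1 := map_smul_sub_dvd_prod (ϖ' := ϖ') T q ι hι hdesc g
  have h2 := prod_dvd_map_smul_sub T' hgen q.ker (b := ι ϖ) (fun h hh => by
    rw [← hι, (MonoidHom.mem_ker).1 hh, one_smul]) g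
  rw [← hι, ← map_sub] at h2
  rw [displacement, ← hval]
  have h3 : ∑ h : q.ker, displacement ϖ' (g * h) =
      addVal B' (∏ h : q.ker, ((g * h) • ϖ' - ϖ')) := by
    have : ∀ s : Finset q.ker, ∑ h ∈ s, displacement ϖ' (g * h) =
        addVal B' (∏ h ∈ s, ((g * h) • ϖ' - ϖ')) := by
      classical
      intro s
      induction s using Finset.induction_on with
      | empty => simp
      | insert a s ha ih => rw [Finset.sum_insert ha, Finset.prod_insert ha, addVal_mul, ih]; rfl
    exact this _
  rw [h3]
  exact le_antisymm (addVal_le_iff_dvd.2 h1) (addVal_le_iff_dvd.2 h2)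

end Quotient

end IsTotallyRamifiedAction

/-- The combinatorial core of Herbrand's theorem: passing to a quotient divides
`∑ₛ min (i s) (i g)` by the order of the kernel, if `g` maximizes `i` in its coset. -/
theorem sum_min_eq_card_ker_mul_sum_min {G G' : Type*} [Group G] [Group G'] [Fintype G] [Fintype G']
    (q : G' →* G) (hq : Function.Surjective q) [Fintype q.ker] {i : G → ℕ∞} {i' : G' → ℕ∞}
    (hmul : ∀ g h, min (i' g) (i' h) ≤ i' (g * h)) (hinv : ∀ g, i' g⁻¹ = i' g)
    (hsum : ∀ g, Nat.card q.ker * i (q g) = ∑ h : q.ker, i' (g * h)) (g : G')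
    (hg : ∀ h ∈ q.ker, i' (g * h) ≤ i' g) :
    ∑ s, min (i' s) (i' g) = Nat.card q.ker * ∑ s, min (i s) (i (q g)) := by
  classical
  -- The ultrametric inequality, applied to g·h and to g⁻¹·(gh), determines i' on the coset of a
  -- maximizer.
  have hmin : ∀ g, (∀ h ∈ q.ker, i' (g * h) ≤ i' g) → ∀ h ∈ q.ker,
      i' (g * h) = min (i' h) (i' g) := by
    intro g hg h hh
    refine le_antisymm (le_min ?_ (hg h hh)) ((min_comm _ _).trans_le (hmul g h))
    have := hmul g⁻¹ (g * h)
    rwa [hinv, inv_mul_cancel_left, min_eq_right (hg h hh)] at this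
  have hmax : ∀ t : G, ∃ r, q r = t ∧ ∀ h ∈ q.ker, i' (r * h) ≤ i' r := by
    intro t
    obtain ⟨r0, hr0⟩ := hq t
    obtain ⟨⟨h0, hh0⟩, -, hm⟩ := Finset.exists_max_image (Finset.univ : Finset q.ker)
      (fun h => i' (r0 * h)) ⟨1, Finset.mem_univ _⟩
    refine ⟨r0 * h0, by rw [map_mul, hr0, MonoidHom.mem_ker.1 hh0, mul_one], fun h hh => ?_⟩
    have := hm ⟨h0 * h, mul_mem hh0 hh⟩ (Finset.mem_univ _)
    rwa [Subgroup.coe_mk, Subgroup.coe_mk, ← mul_assoc] at this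
  choose r hr hrmax using hmax
  -- Enumerate each coset from a representative maximizing i', so that the sum can be compared coset
  -- by coset.
  let e : G × q.ker ≃ G' :=
    { toFun := fun x => r x.1 * x.2
      invFun := fun s => (q s, ⟨(r (q s))⁻¹ * s, by
        rw [MonoidHom.mem_ker, map_mul, map_inv, hr, inv_mul_cancel]⟩)
      left_inv := fun x => by
        have hx : q (r x.1 * x.2) = x.1 := by
          rw [map_mul, hr, MonoidHom.mem_ker.1 x.2.2, mul_one]
        refine Prod.ext hx (Subtype.ext ?_)
        simp only [hx, inv_mul_cancel_left]
      right_inv := fun s => mul_inv_cancel_left _ _ }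
  rw [← e.sum_comp, Fintype.sum_prod_type, Finset.mul_sum]
  refine Finset.sum_congr rfl fun t _ => ?_
  have hcalc : ∀ g, (∀ h ∈ q.ker, i' (g * h) ≤ i' g) →
      Nat.card q.ker * i (q g) = ∑ h : q.ker, min (i' h) (i' g) := fun g hg => by
    rw [hsum]
    exact Finset.sum_congr rfl fun h _ => hmin g hg h h.2
  have hrt := hcalc (r t) (hrmax t)
  have hgg := hcalc g hg
  rw [hr] at hrt
  rw [show (Nat.card q.ker : ℕ∞) * min (i t) (i (q g)) =
    min (Nat.card q.ker * i t) (Nat.card q.ker * i (q g)) from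
      (Monotone.map_min (f := fun x : ℕ∞ => (Nat.card q.ker : ℕ∞) * x)
        fun a b hab => by dsimp only; gcongr), hrt, hgg]
  have hL : ∀ h : q.ker, min (i' (e (t, h))) (i' g) = min (i' h) (min (i' (r t)) (i' g)) := by
    intro h
    rw [show e (t, h) = r t * h from rfl, hmin _ (hrmax t) h h.2, min_assoc]
  simp_rw [hL]
  rcases le_total (i' (r t)) (i' g) with h | h
  · rw [min_eq_left h, min_eq_left (Finset.sum_le_sum fun x _ => min_le_min_left _ h)]
  · rw [min_eq_right h, min_eq_right (Finset.sum_le_sum fun x _ => min_le_min_left _ h)]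

end

noncomputable section

/-! ### The upper numbering -/

open IsLocalRing
open IsDiscreteValuationRing hiding maximalIdeal
open IsTotallyRamifiedAction

/-- The minimum of i(s) and n counts the j < n with s in G_j. -/
theorem IsTotallyRamifiedAction.sum_min_displacement {G B : Type*} [Group G] [Fintype G]
    [CommRing B] [IsDomain B] [IsDiscreteValuationRing B] [MulSemiringAction G B] {ϖ : B}
    (T : IsTotallyRamifiedAction G ϖ) (n : ℕ) :
    ∑ s : G, min (displacement ϖ s) (n : ℕ∞) =
      ((∑ j ∈ Finset.range n, Nat.card (ram G ϖ j) : ℕ) : ℕ∞) := by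
  classical
  induction n with
  | zero => simp
  | succ n ih =>
    have h1 : ∀ s : G, min (displacement ϖ s) ((n + 1 : ℕ) : ℕ∞) =
        min (displacement ϖ s) (n : ℕ∞) + if s ∈ ram G ϖ n then 1 else 0 := by
      intro s
      rw [T.mem_ram_iff_le_displacement]
      split_ifs with h
      · rw [min_eq_right h, min_eq_right ((Nat.cast_le.2 (Nat.le_succ n)).trans h), Nat.cast_succ]
      · have h' : displacement ϖ s ≤ n := by
          rw [not_le, Nat.cast_succ] at h
          exact Order.le_of_lt_add_one h
        rw [min_eq_left h', add_zero, min_eq_left (h'.trans (Nat.cast_le.2 (Nat.le_succ n)))]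
    simp_rw [h1]
    rw [Finset.sum_add_distrib, ih, Finset.sum_range_succ, Nat.cast_add, Finset.sum_boole,
      Nat.card_eq_fintype_card, Fintype.card_subtype]

section LaurentSeries

variable {k : Type*} [Field k] [IsAlgClosed k]

section

variable {L : Type*} [Field L] [Algebra k⸨X⸩ L] [Algebra k⟦X⟧ L] [IsScalarTower k⟦X⟧ k⸨X⸩ L]
  [FiniteDimensional k⸨X⸩ L] [IsGalois k⸨X⸩ L]

local notation "𝓑" => integralClosure k⟦X⟧ L

theorem lowerRamificationGroup_zero : lowerRamificationGroup k⟦X⟧ k⸨X⸩ L 0 = ⊤ := by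
  obtain ⟨ϖ, hϖ⟩ := exists_irreducible 𝓑
  rw [lowerRamificationGroup_eq_ram hϖ, (isTotallyRamifiedAction hϖ).ram_zero]

variable (k L) in
omit [FiniteDimensional k⸨X⸩ L] [IsGalois k⸨X⸩ L] [IsAlgClosed k] in
theorem herbrand_monotone : Monotone (herbrand k⟦X⟧ k⸨X⸩ L) := by
  intro a b hab
  unfold herbrand
  gcongr

variable (k L) in
theorem card_mul_herbrand (m : ℕ) : (Nat.card Gal(L/k⸨X⸩) : ℝ) * herbrand k⟦X⟧ k⸨X⸩ L m =
    ∑ i ∈ Finset.Icc 1 m, (Nat.card (lowerRamificationGroup k⟦X⟧ k⸨X⸩ L i) : ℝ) := by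
  rw [herbrand, lowerRamificationGroup_zero, Subgroup.card_top, mul_div_cancel₀]
  exact_mod_cast Nat.card_pos.ne'

variable (k L) in
theorem exists_le_herbrand (y : ℝ) : ∃ m, y ≤ herbrand k⟦X⟧ k⸨X⸩ L m := by
  have hpos : (0 : ℝ) < Nat.card Gal(L/k⸨X⸩) := by exact_mod_cast Nat.card_pos
  obtain ⟨m, hm⟩ := exists_nat_ge (Nat.card Gal(L/k⸨X⸩) * y)
  refine ⟨m, le_of_mul_le_mul_left (hm.trans ?_) hpos⟩
  rw [card_mul_herbrand]
  have : ∑ i ∈ Finset.Icc 1 m, (1 : ℝ) ≤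
      ∑ i ∈ Finset.Icc 1 m, (Nat.card (lowerRamificationGroup k⟦X⟧ k⸨X⸩ L i) : ℝ) :=
    Finset.sum_le_sum fun i _ => by exact_mod_cast Nat.card_pos
  simpa using this

theorem sInf_le_herbrand_le_iff (y : ℝ) (m : ℕ) :
    sInf {m | y ≤ herbrand k⟦X⟧ k⸨X⸩ L m} ≤ m ↔ y ≤ herbrand k⟦X⟧ k⸨X⸩ L m :=
  ⟨fun h => le_trans (Nat.sInf_mem (exists_le_herbrand k L y) : y ≤ _) (herbrand_monotone k L h),
    fun h => Nat.sInf_le h⟩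

/-- For g ≠ 1 the sum equals |G|(φ(i(g) - 1) + 1), so upper numbering is read off from i alone, a
form that scales well under quotients. For g = 1 the sum is infinite and no N qualifies. -/
theorem mem_upperRamificationGroup_iff [Fintype Gal(L/k⸨X⸩)] {ϖ : 𝓑} (hϖ : Irreducible ϖ) (y : ℝ)
    (g : Gal(L/k⸨X⸩)) : g ∈ upperRamificationGroup k⟦X⟧ k⸨X⸩ L y ↔
      ∀ N : ℕ, ∑ s : Gal(L/k⸨X⸩), min (displacement ϖ s) (displacement ϖ g) = N →
        (y + 1) * Nat.card Gal(L/k⸨X⸩) ≤ N := by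
  have T := isTotallyRamifiedAction hϖ
  rw [upperRamificationGroup, lowerRamificationGroup_eq_ram hϖ]
  rcases eq_or_ne g 1 with rfl | hg
  · simp only [one_mem, true_iff]
    intro N hN
    have h1 : displacement ϖ (1 : Gal(L/k⸨X⸩)) = ⊤ := T.displacement_eq_top_iff.2 rfl
    have h2 := Finset.single_le_sum (f := fun s : Gal(L/k⸨X⸩) =>
      min (displacement ϖ s) (displacement ϖ (1 : Gal(L/k⸨X⸩)))) (fun _ _ => zero_le)
      (Finset.mem_univ (1 : Gal(L/k⸨X⸩)))
    rw [hN] at h2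
    simp only [h1, min_self, top_le_iff] at h2
    exact absurd h2 (ENat.natCast_ne_top N)
  · obtain ⟨n, hn⟩ := ENat.ne_top_iff_exists.1 (mt T.displacement_eq_top_iff.1 hg)
    have h1 : 0 < n := by
      have h0 : g ∈ ram Gal(L/k⸨X⸩) ϖ 0 := by rw [T.ram_zero]; trivial
      rw [T.mem_ram_iff_le_displacement, ← hn, Nat.cast_le] at h0
      exact h0
    obtain ⟨m, rfl⟩ : ∃ m, n = m + 1 := ⟨n - 1, by omega⟩
    rw [T.mem_ram_iff_le_displacement, ← hn, Nat.cast_le, Nat.add_le_add_iff_right,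
      sInf_le_herbrand_le_iff, T.sum_min_displacement]
    have hpos : (0 : ℝ) < Nat.card Gal(L/k⸨X⸩) := by exact_mod_cast Nat.card_pos
    have h2 : ((∑ j ∈ Finset.range (m + 1), Nat.card (ram Gal(L/k⸨X⸩) ϖ j) : ℕ) : ℝ) =
        (herbrand k⟦X⟧ k⸨X⸩ L m + 1) * Nat.card Gal(L/k⸨X⸩) := by
      rw [add_mul, one_mul, mul_comm, card_mul_herbrand, Finset.range_eq_Ico,
        Finset.sum_eq_sum_Ico_succ_bot (by omega), T.ram_zero, Subgroup.card_top]
      simp_rw [lowerRamificationGroup_eq_ram hϖ]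
      push_cast
      rw [add_comm]
      rfl
    constructor
    · intro h N hN
      rw [← Nat.cast_inj.1 hN, h2]
      gcongr
    · intro h
      have := h _ rfl
      rw [h2] at this
      linarith [le_of_mul_le_mul_right this hpos]

end

/-! ### Upper numbering in a tower of Galois extensions -/

section Tower

variable {L M : Type*} [Field L] [Algebra k⸨X⸩ L] [Algebra k⟦X⟧ L] [IsScalarTower k⟦X⟧ k⸨X⸩ L]
  [FiniteDimensional k⸨X⸩ L] [IsGalois k⸨X⸩ L]
  [Field M] [Algebra k⸨X⸩ M] [Algebra k⟦X⟧ M] [IsScalarTower k⟦X⟧ k⸨X⸩ M]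
  [FiniteDimensional k⸨X⸩ M] [IsGalois k⸨X⸩ M] [Algebra L M] [IsScalarTower k⸨X⸩ L M]
  [IsScalarTower k⟦X⟧ L M]

variable (k L M) in
/-- The inclusion of rings of integers. -/
def integersMap : integralClosure k⟦X⟧ L →ₐ[k⟦X⟧] integralClosure k⟦X⟧ M :=
  (IsScalarTower.toAlgHom k⟦X⟧ L M).mapIntegralClosure

omit [IsAlgClosed k] [FiniteDimensional k⸨X⸩ L] [FiniteDimensional k⸨X⸩ M] [IsGalois k⸨X⸩ M] in
theorem integersMap_smul (g : Gal(M/k⸨X⸩)) (b : integralClosure k⟦X⟧ L) :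
    integersMap k L M (AlgEquiv.restrictNormalHom L g • b) = g • integersMap k L M b :=
  Subtype.ext (AlgEquiv.restrictNormal_commutes g L b)

omit [IsAlgClosed k] [IsScalarTower k⟦X⟧ k⸨X⸩ L] [FiniteDimensional k⸨X⸩ L] in
theorem exists_integersMap_eq (b : integralClosure k⟦X⟧ M)
    (hb : ∀ h ∈ (AlgEquiv.restrictNormalHom (F := k⸨X⸩) (K₁ := M) L).ker, h • b = b) :
    ∃ a, integersMap k L M a = b := by
  have : IsGalois L M := IsGalois.tower_top_of_isGalois k⸨X⸩ L M
  have : FiniteDimensional L M := FiniteDimensional.right k⸨X⸩ L M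
  obtain ⟨x, hx⟩ := (IsGalois.mem_range_algebraMap_iff_fixed (F := L) (b : M)).2 fun τ => by
    refine congrArg Subtype.val (hb (τ.restrictScalars k⸨X⸩) ?_)
    rw [MonoidHom.mem_ker]
    refine AlgEquiv.ext fun x => (algebraMap L M).injective ?_
    exact (AlgEquiv.restrictNormal_commutes (τ.restrictScalars k⸨X⸩) L x).trans (τ.commutes x)
  have hxi : IsIntegral k⟦X⟧ x := by
    rw [← isIntegral_algebraMap_iff (B := M) (algebraMap L M).injective, hx]
    exact b.2
  exact ⟨⟨x, hxi⟩, Subtype.ext hx⟩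

omit [IsAlgClosed k] [Algebra k⟦X⟧ L] [IsScalarTower k⟦X⟧ k⸨X⸩ L] [FiniteDimensional k⸨X⸩ L]
  [Algebra k⟦X⟧ M] [IsScalarTower k⟦X⟧ k⸨X⸩ M] [FiniteDimensional k⸨X⸩ M]
  [IsScalarTower k⟦X⟧ L M] in
theorem card_ker_restrictNormalHom :
    Nat.card (AlgEquiv.restrictNormalHom (F := k⸨X⸩) (K₁ := M) L).ker * Nat.card Gal(L/k⸨X⸩) =
      Nat.card Gal(M/k⸨X⸩) := by
  rw [← Subgroup.card_mul_index (AlgEquiv.restrictNormalHom (F := k⸨X⸩) (K₁ := M) L).ker,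
    Subgroup.index_ker, MonoidHom.range_eq_top.2 (AlgEquiv.restrictNormalHom_surjective M),
    Subgroup.card_top]

/-- The ramification index of M/L is the quotient of the two valuations of X, which are the degrees
over k((X)). -/
theorem addVal_integersMap (b : integralClosure k⟦X⟧ L) :
    addVal (integralClosure k⟦X⟧ M) (integersMap k L M b) =
      Nat.card (AlgEquiv.restrictNormalHom (F := k⸨X⸩) (K₁ := M) L).ker *
        addVal (integralClosure k⟦X⟧ L) b := by
  obtain ⟨ϖ, hϖ⟩ := exists_irreducible (integralClosure k⟦X⟧ L)
  have hinj : Function.Injective (integersMap k L M) := fun x y h =>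
    Subtype.ext ((algebraMap L M).injective (congrArg Subtype.val h))
  have key : ∀ b : integralClosure k⟦X⟧ L, b ≠ 0 →
      addVal (integralClosure k⟦X⟧ M) (integersMap k L M b) =
        addVal (integralClosure k⟦X⟧ M) (integersMap k L M ϖ) *
          addVal (integralClosure k⟦X⟧ L) b := by
    intro b hb
    obtain ⟨n, u, hu⟩ := eq_unit_mul_pow_irreducible hb hϖ
    rw [addVal_def b u hϖ n hu, hu, map_mul, map_pow, addVal_mul, addVal_pow,
      addVal_eq_zero_iff.2 (u.isUnit.map (integersMap k L M)), zero_add, nsmul_eq_mul, mul_comm]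
  rcases eq_or_ne b 0 with rfl | hb
  · rw [map_zero, addVal_zero, addVal_zero, ENat.mul_top (by exact_mod_cast Nat.card_pos.ne')]
  have hX := key (algebraMap k⟦X⟧ _ PowerSeries.X) algebraMap_X_ne_zero
  rw [AlgHom.commutes, addVal_X, addVal_X, ← IsGalois.card_aut_eq_finrank,
    ← IsGalois.card_aut_eq_finrank, ← card_ker_restrictNormalHom (L := L) (M := M)] at hX
  rw [key b hb]
  congr 1
  have hne : addVal _ (integersMap k L M ϖ) ≠ ⊤ := by
    rw [Ne, addVal_eq_top_iff, map_eq_zero_iff _ hinj]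
    exact hϖ.ne_zero
  obtain ⟨e, he⟩ := ENat.ne_top_iff_exists.1 hne
  rw [← he] at hX ⊢
  have hX' : Nat.card (AlgEquiv.restrictNormalHom (F := k⸨X⸩) (K₁ := M) L).ker *
    Nat.card Gal(L/k⸨X⸩) = e * Nat.card Gal(L/k⸨X⸩) := by exact_mod_cast hX
  rw [Nat.eq_of_mul_eq_mul_right Nat.card_pos hX']

/-- Herbrand's theorem. -/
theorem map_upperRamificationGroup (y : ℝ) :
    (upperRamificationGroup k⟦X⟧ k⸨X⸩ M y).map (AlgEquiv.restrictNormalHom L) =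
      upperRamificationGroup k⟦X⟧ k⸨X⸩ L y := by
  classical
  obtain ⟨ϖ, hϖ⟩ := exists_irreducible (integralClosure k⟦X⟧ L)
  obtain ⟨ϖ', hϖ'⟩ := exists_irreducible (integralClosure k⟦X⟧ M)
  have T := isTotallyRamifiedAction hϖ
  have T' := isTotallyRamifiedAction hϖ'
  have := Fintype.ofFinite Gal(L/k⸨X⸩)
  have := Fintype.ofFinite Gal(M/k⸨X⸩)
  set q : Gal(M/k⸨X⸩) →* Gal(L/k⸨X⸩) := AlgEquiv.restrictNormalHom L with hqdef
  have := Fintype.ofFinite q.ker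
  have hq : Function.Surjective q := AlgEquiv.restrictNormalHom_surjective M
  have hsum := fun g => card_ker_mul_displacement (A := k⟦X⟧) T T' (adjoin_uniformizer_eq_top hϖ') q
    (integersMap k L M).toRingHom integersMap_smul exists_integersMap_eq addVal_integersMap g
  have hU := fun g hg => sum_min_eq_card_ker_mul_sum_min q hq min_displacement_le_mul
    displacement_inv hsum g hg
  have hcard : Nat.card q.ker * Nat.card Gal(L/k⸨X⸩) = Nat.card Gal(M/k⸨X⸩) :=
    card_ker_restrictNormalHom
  have hpos : (0 : ℝ) < Nat.card q.ker := by exact_mod_cast Nat.card_pos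
  -- For a maximizer in its coset, both sides of the numerical criterion for M are those for L times
  -- the order of the kernel.
  have hiff : ∀ g, (∀ h ∈ q.ker, displacement ϖ' (g * h) ≤ displacement ϖ' g) →
      (g ∈ upperRamificationGroup k⟦X⟧ k⸨X⸩ M y ↔
        q g ∈ upperRamificationGroup k⟦X⟧ k⸨X⸩ L y) := by
    intro g hg
    rw [mem_upperRamificationGroup_iff hϖ', mem_upperRamificationGroup_iff hϖ, hU g hg]
    constructor
    · intro h N hN
      have := h (Nat.card q.ker * N) (by rw [hN]; push_cast; rfl)
      rw [← hcard] at this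
      push_cast at this
      refine le_of_mul_le_mul_left ?_ hpos
      linarith
    · intro h N hN
      obtain ⟨N', hN'⟩ : ∃ N' : ℕ, (N' : ℕ∞) =
          ∑ s, min (displacement ϖ s) (displacement ϖ (q g)) := by
        have hne : ∑ s : Gal(L/k⸨X⸩), min (displacement ϖ s) (displacement ϖ (q g)) ≠ ⊤ := by
          intro htop
          rw [htop, ENat.mul_top (by exact_mod_cast Nat.card_pos.ne')] at hN
          exact ENat.natCast_ne_top N hN.symm
        exact ENat.ne_top_iff_exists.1 hne
      rw [← hN'] at hN
      have hN2 : Nat.card q.ker * N' = N := by exact_mod_cast hN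
      have := h N' hN'.symm
      rw [← hcard, ← hN2]
      push_cast
      have := mul_le_mul_of_nonneg_left this hpos.le
      linarith
  have hmax : ∀ g : Gal(M/k⸨X⸩), ∃ g', q g' = q g ∧ displacement ϖ' g ≤ displacement ϖ' g' ∧
      ∀ h ∈ q.ker, displacement ϖ' (g' * h) ≤ displacement ϖ' g' := by
    intro g
    obtain ⟨g', hg', hm⟩ := Finset.exists_max_image
      (Finset.univ.filter fun g' => q g' = q g) (displacement ϖ') ⟨g, by simp⟩
    rw [Finset.mem_filter] at hg'
    refine ⟨g', hg'.2, hm g (by simp), fun h hh => hm _ ?_⟩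
    rw [Finset.mem_filter, map_mul, MonoidHom.mem_ker.1 hh, mul_one]
    exact ⟨Finset.mem_univ _, hg'.2⟩
  ext σ
  rw [Subgroup.mem_map]
  constructor
  -- Replacing g by a maximizer of its coset keeps its image and only increases the displacement, so
  -- membership persists.
  · rintro ⟨g, hg, rfl⟩
    obtain ⟨g', h1, h2, h3⟩ := hmax g
    rw [← h1, ← hiff g' h3]
    rw [upperRamificationGroup, lowerRamificationGroup_eq_ram hϖ',
      T'.mem_ram_iff_le_displacement] at hg ⊢
    exact hg.trans h2
  · intro hσ
    obtain ⟨g, rfl⟩ := hq σ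
    obtain ⟨g', h1, -, h3⟩ := hmax g
    exact ⟨g', (hiff g' h3).2 (h1 ▸ hσ), h1⟩

end Tower

end LaurentSeries
end

noncomputable section

/-! ### Ramification in the absolute Galois group of `k((t))` -/

open AlgEquiv (restrictNormalHom)

section InertiaGroup

variable {k : Type*} [Field k]

local notation "𝓕" => FiniteGaloisIntermediateField k⸨X⸩ (SeparableClosure k⸨X⸩)

theorem restrictNormalHom_eq_one_of_le {L M : 𝓕} (h : L ≤ M) {g : InertiaGroup k}
    (hg : restrictNormalHom M g = 1) : restrictNormalHom L g = 1 := by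
  rw [← MonoidHom.mem_ker, IntermediateField.restrictNormalHom_ker] at hg ⊢
  exact IntermediateField.fixingSubgroup_antitone h hg

theorem mem_upperRamification {y : ℝ} {g : InertiaGroup k} : g ∈ upperRamification k y ↔
    ∀ L : 𝓕, restrictNormalHom L g ∈ upperRamificationGroup k⟦X⟧ k⸨X⸩ L y := by
  simp [upperRamification, Subgroup.mem_iInf]

variable [IsAlgClosed k]

theorem upperRamificationGroup_restrict_of_le {L M : 𝓕} (h : L ≤ M) {y : ℝ} {g : InertiaGroup k}
    (hg : restrictNormalHom M g ∈ upperRamificationGroup k⟦X⟧ k⸨X⸩ M y) :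
    restrictNormalHom L g ∈ upperRamificationGroup k⟦X⟧ k⸨X⸩ L y := by
  let _ : Algebra L M := (IntermediateField.inclusion h).toRingHom.toAlgebra
  let _ : SMul L M := Algebra.toSMul
  have : IsScalarTower k⸨X⸩ L M := IsScalarTower.of_algebraMap_eq' rfl
  have : IsScalarTower k⟦X⟧ L M := IsScalarTower.of_algebraMap_eq' rfl
  have : IsScalarTower L M (SeparableClosure k⸨X⸩) := IsScalarTower.of_algebraMap_eq' rfl
  rw [IsScalarTower.AlgEquiv.restrictNormalHom_comp_apply L M, ← map_upperRamificationGroup (M := M)]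
  exact Subgroup.mem_map_of_mem _ hg

theorem exists_restrict_eq_of_le {L M : 𝓕} (h : L ≤ M) {y : ℝ} {σ : Gal(L/k⸨X⸩)}
    (hσ : σ ∈ upperRamificationGroup k⟦X⟧ k⸨X⸩ L y) : ∃ g : InertiaGroup k,
    restrictNormalHom M g ∈ upperRamificationGroup k⟦X⟧ k⸨X⸩ M y ∧ restrictNormalHom L g = σ := by
  let _ : Algebra L M := (IntermediateField.inclusion h).toRingHom.toAlgebra
  let _ : SMul L M := Algebra.toSMul
  have : IsScalarTower k⸨X⸩ L M := IsScalarTower.of_algebraMap_eq' rfl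
  have : IsScalarTower k⟦X⟧ L M := IsScalarTower.of_algebraMap_eq' rfl
  have : IsScalarTower L M (SeparableClosure k⸨X⸩) := IsScalarTower.of_algebraMap_eq' rfl
  rw [← map_upperRamificationGroup (M := M)] at hσ
  obtain ⟨τ, hτ, rfl⟩ := hσ
  obtain ⟨g, rfl⟩ := AlgEquiv.restrictNormalHom_surjective (F := k⸨X⸩) (K₁ := M)
    (SeparableClosure k⸨X⸩) τ
  exact ⟨g, hτ, IsScalarTower.AlgEquiv.restrictNormalHom_comp_apply L M g⟩

/-- The upper numbering filtration of the absolute Galois group surjects onto that of a finite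
quotient. -/
theorem exists_mem_upperRamification_restrict_eq (L : 𝓕) {y : ℝ} {σ : Gal(L/k⸨X⸩)}
    (hσ : σ ∈ upperRamificationGroup k⟦X⟧ k⸨X⸩ L y) :
    ∃ g ∈ upperRamification k y, restrictNormalHom L g = σ := by
  -- Lifts of σ that are correct at level L ⊔ M: non-empty by Herbrand's theorem, closed and
  -- directed, so they have a common point by compactness.
  let C : 𝓕 → Set (InertiaGroup k) := fun M =>
    (restrictNormalHom (L ⊔ M : 𝓕)) ⁻¹' (upperRamificationGroup k⟦X⟧ k⸨X⸩ (L ⊔ M : 𝓕) y) ∩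
      (restrictNormalHom L) ⁻¹' {σ}
  have hclosed : ∀ M, IsClosed (C M) := fun M =>
    ((isClosed_discrete _).preimage (InfiniteGalois.restrictNormalHom_continuous _)).inter
      ((isClosed_discrete _).preimage (InfiniteGalois.restrictNormalHom_continuous _))
  obtain ⟨g, hg⟩ := IsCompact.nonempty_iInter_of_directed_nonempty_isCompact_isClosed C
    (fun M₁ M₂ => ⟨M₁ ⊔ M₂,
      fun g hg => ⟨upperRamificationGroup_restrict_of_le (sup_le_sup_left le_sup_left L) hg.1, hg.2⟩,
      fun g hg => ⟨upperRamificationGroup_restrict_of_le (sup_le_sup_left le_sup_right L) hg.1,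
        hg.2⟩⟩)
    (fun M => by
      obtain ⟨g, h1, h2⟩ := exists_restrict_eq_of_le (le_sup_left : L ≤ L ⊔ M) hσ
      exact ⟨g, h1, h2⟩)
    (fun M => (hclosed M).isCompact) hclosed
  rw [Set.mem_iInter] at hg
  exact ⟨g, mem_upperRamification.2 fun M =>
    upperRamificationGroup_restrict_of_le le_sup_right (hg M).1, (hg L).2⟩

theorem upperRamificationGroup_normal (L : 𝓕) (y : ℝ) :
    (upperRamificationGroup k⟦X⟧ k⸨X⸩ L y).Normal := by
  obtain ⟨ϖ, hϖ⟩ := IsDiscreteValuationRing.exists_irreducible (integralClosure k⟦X⟧ L)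
  rw [upperRamificationGroup, lowerRamificationGroup_eq_ram hϖ]
  exact (isTotallyRamifiedAction hϖ).ram_normal _

instance upperRamification_normal (y : ℝ) : (upperRamification k y).Normal :=
  Subgroup.normal_iInf_normal fun L => (upperRamificationGroup_normal L y).comap _

theorem residueField_natCast_eq_zero (p : ℕ) [CharP k p] (L : 𝓕) :
    (p : IsLocalRing.ResidueField (integralClosure k⟦X⟧ L)) = 0 := by
  have h : (p : k⟦X⟧) = 0 := by
    rw [← map_natCast (PowerSeries.C (R := k)), CharP.cast_eq_zero, map_zero]
  rw [← map_natCast ((IsLocalRing.residue _).comp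
    (algebraMap k⟦X⟧ (integralClosure k⟦X⟧ L))), h, map_zero]

/-- As φ(0) = 0 < x, the lower index is at least 1 and the wild theory applies. The inequality may
be strict, when x is not a value of φ at an integer. -/
theorem upperRamificationGroup_eq_lower_succ (L : 𝓕) {x : ℝ} (hx : 0 < x) :
    ∃ i, upperRamificationGroup k⟦X⟧ k⸨X⸩ L x = lowerRamificationGroup k⟦X⟧ k⸨X⸩ L (i + 1) ∧
      x ≤ herbrand k⟦X⟧ k⸨X⸩ L (i + 1) := by
  have h0 : sInf {m | x ≤ herbrand k⟦X⟧ k⸨X⸩ L m} ≠ 0 := by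
    intro h
    have := (sInf_le_herbrand_le_iff (L := L) x 0).1 h.le
    simp only [herbrand, zero_lt_one, Finset.Icc_eq_empty_of_lt, Finset.sum_empty, zero_div] at this
    linarith
  obtain ⟨i, hi⟩ := Nat.exists_eq_succ_of_ne_zero h0
  refine ⟨i, by rw [upperRamificationGroup, hi], ?_⟩
  exact (sInf_le_herbrand_le_iff (L := L) x (i + 1)).1 hi.le

theorem exists_restrict_pow_eq_one (p : ℕ) [Fact p.Prime] [CharP k p] {x : ℝ} (hx : 0 < x)
    {g : InertiaGroup k} (hg : g ∈ upperRamification k x) (L : 𝓕) :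
    ∃ n : ℕ, restrictNormalHom L (g ^ p ^ n) = 1 := by
  obtain ⟨ϖ, hϖ⟩ := IsDiscreteValuationRing.exists_irreducible (integralClosure k⟦X⟧ L)
  obtain ⟨i, hi, -⟩ := upperRamificationGroup_eq_lower_succ L hx
  have h1 := mem_upperRamification.1 hg L
  rw [hi, lowerRamificationGroup_eq_ram hϖ] at h1
  obtain ⟨n, hn⟩ := (isTotallyRamifiedAction hϖ).isPGroup_ram_one
    (residueField_natCast_eq_zero p L)
    ⟨_, IsTotallyRamifiedAction.ram_antitone (Nat.le_add_left 1 i) h1⟩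
  exact ⟨n, by rw [map_pow]; exact congrArg Subtype.val hn⟩

end InertiaGroup

/-! ### Finiteness of the wild image -/

section Ultrametric

variable {𝕜 ι : Type*} [NormedField 𝕜] [IsUltrametricDist 𝕜] [Fintype ι] [DecidableEq ι]

omit [DecidableEq ι] in
theorem Matrix.norm_mul_apply_le {A B : Matrix ι ι 𝕜} {a b : ℝ} (ha : 0 ≤ a) (hb : 0 ≤ b)
    (hA : ∀ i j, ‖A i j‖ ≤ a) (hB : ∀ i j, ‖B i j‖ ≤ b) (i j : ι) : ‖(A * B) i j‖ ≤ a * b := by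
  rw [Matrix.mul_apply]
  refine IsUltrametricDist.norm_sum_le_of_forall_le_of_nonneg (mul_nonneg ha hb) fun l _ => ?_
  rw [norm_mul]
  gcongr
  exacts [hA _ _, hB _ _]

theorem Matrix.norm_one_add_pow_sub_le {B : Matrix ι ι 𝕜} {b : ℝ} (hb0 : 0 ≤ b) (hb : b ≤ 1)
    (hB : ∀ i j, ‖B i j‖ ≤ b) (n : ℕ) (i j : ι) :
    ‖((1 + B) ^ n - (1 + (n : 𝕜) • B)) i j‖ ≤ b ^ 2 := by
  induction n generalizing i j with
  | zero => simp; positivity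
  | succ n ih =>
    have : (1 + B) ^ (n + 1) - (1 + ((n + 1 : ℕ) : 𝕜) • B) =
        ((1 + B) ^ n - (1 + (n : 𝕜) • B)) + (((1 + B) ^ n - (1 + (n : 𝕜) • B)) * B +
          (n : 𝕜) • (B * B)) := by
      rw [pow_succ, Nat.cast_succ, add_smul, one_smul]
      simp only [mul_add, sub_mul, add_mul, mul_one, one_mul, Matrix.smul_mul]
      abel
    rw [this, Matrix.add_apply, Matrix.add_apply]
    refine (IsUltrametricDist.norm_add_le_max _ _).trans (max_le (ih i j)
      ((IsUltrametricDist.norm_add_le_max _ _).trans (max_le ?_ ?_)))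
    · refine (Matrix.norm_mul_apply_le (by positivity) hb0 ih hB i j).trans ?_
      exact mul_le_of_le_one_right (by positivity) hb
    · rw [Matrix.smul_apply, norm_smul]
      refine (mul_le_of_le_one_left (norm_nonneg _)
        (IsUltrametricDist.norm_natCast_le_one 𝕜 n)).trans ?_
      rw [pow_two]
      exact Matrix.norm_mul_apply_le hb0 hb0 hB hB i j

/-- With B = A - 1, A^p - 1 is pB up to an error of size b² < b, and p is a unit; so taking p-th
powers never brings A closer to 1. -/
theorem Matrix.norm_pow_pow_sub_one_apply {p : ℕ} (hp : ‖(p : 𝕜)‖ = 1) {A : Matrix ι ι 𝕜} {b : ℝ}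
    (hb0 : 0 < b) (hb : b < 1) (hA : ∀ i j, ‖(A - 1) i j‖ ≤ b) {i j : ι} (hij : ‖(A - 1) i j‖ = b)
    (n : ℕ) : (∀ i j, ‖(A ^ p ^ n - 1) i j‖ ≤ b) ∧ ‖(A ^ p ^ n - 1) i j‖ = b := by
  induction n with
  | zero => simpa using ⟨hA, hij⟩
  | succ n ih =>
    set B := A ^ p ^ n - 1 with hB
    have hb2 : b ^ 2 < b := by nlinarith
    have hdec : A ^ p ^ (n + 1) - 1 = ((1 + B) ^ p - (1 + (p : 𝕜) • B)) + (p : 𝕜) • B := by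
      rw [hB, pow_succ, pow_mul]
      simp only [add_sub_cancel]
      abel
    have hpB : ∀ i j, ‖((p : 𝕜) • B) i j‖ = ‖B i j‖ := fun i j => by
      rw [Matrix.smul_apply, norm_smul, hp, one_mul]
    have hR := Matrix.norm_one_add_pow_sub_le hb0.le hb.le ih.1 p
    rw [hdec]
    refine ⟨fun i j => ?_, ?_⟩
    · rw [Matrix.add_apply]
      refine (IsUltrametricDist.norm_add_le_max _ _).trans (max_le ((hR i j).trans hb2.le) ?_)
      rw [hpB]
      exact ih.1 i j
    · rw [Matrix.add_apply, IsUltrametricDist.norm_add_eq_max_of_norm_ne_norm, hpB, ih.2,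
        max_eq_right ((hR i j).trans hb2.le)]
      rw [hpB, ih.2]
      exact ((hR i j).trans_lt hb2).ne

end Ultrametric

section Continuous

variable {k : Type*} [Field k] [IsAlgClosed k] {ℓ : ℕ} [Fact ℓ.Prime]
  {V : Type*} [AddCommGroup V] [Module (PadicAlgCl ℓ) V] [FiniteDimensional (PadicAlgCl ℓ) V]

local notation "𝓕" => FiniteGaloisIntermediateField k⸨X⸩ (SeparableClosure k⸨X⸩)

theorem PadicAlgCl.norm_natCast_eq_one {p ℓ : ℕ} [Fact ℓ.Prime] [Fact p.Prime] (h : ℓ ≠ p) :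
    ‖(p : PadicAlgCl ℓ)‖ = 1 := by
  rw [← map_natCast (algebraMap ℚ_[ℓ] (PadicAlgCl ℓ)), PadicAlgCl.norm_extends,
    Padic.norm_natCast_eq_one_iff]
  exact (Nat.coprime_primes Fact.out Fact.out).2 h

/-- The wild ramification groups act on a continuous `ℓ`-adic representation through a finite
quotient. -/
theorem exists_forall_restrict_eq_one_apply_eq_one (p : ℕ) [Fact p.Prime] [CharP k p] (hℓ : ℓ ≠ p)
    {ρ : Representation (PadicAlgCl ℓ) (InertiaGroup k) V} (hρ : IsContinuousRep ρ) {x : ℝ}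
    (hx : 0 < x) : ∃ L : 𝓕, ∀ g ∈ upperRamification k x, restrictNormalHom L g = 1 → ρ g = 1 := by
  classical
  let e := Module.finBasis (PadicAlgCl ℓ) V
  let A : InertiaGroup k →* Matrix _ _ (PadicAlgCl ℓ) :=
    (LinearMap.toMatrixAlgEquiv e).toMulEquiv.toMonoidHom.comp ρ
  have hA : ∀ i j, Continuous fun g => A g i j := fun i j => by
    have : (fun g => A g i j) = fun g => e.coord i (ρ g (e j)) := by
      ext g
      exact LinearMap.toMatrixAlgEquiv_apply e (ρ g) i j
    rw [this]
    exact hρ _ _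
  have hnhds : ∀ b > 0, ∃ L : 𝓕, ∀ g, restrictNormalHom L g = 1 → ∀ i j, ‖(A g - 1) i j‖ < b := by
    intro b hb
    have h1 : {g | ∀ i j, ‖(A g - 1) i j‖ < b} ∈ nhds (1 : InertiaGroup k) := by
      have hopen : IsOpen {g | ∀ i j, ‖(A g - 1) i j‖ < b} := by
        simp only [Set.ofPred_forall]
        refine isOpen_iInter_of_finite fun i => isOpen_iInter_of_finite fun j => ?_
        refine isOpen_lt (Continuous.norm ?_) continuous_const
        exact (hA i j).sub continuous_const
      exact hopen.mem_nhds fun i j => by simpa using hb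
    obtain ⟨L, hL⟩ := (InfiniteGalois.krullTopology_mem_nhds_one_iff_of_isGalois _).1 h1
    refine ⟨L, fun g hg => hL ?_⟩
    rwa [← MonoidHom.mem_ker, IntermediateField.restrictNormalHom_ker] at hg
  obtain ⟨L, hL⟩ := hnhds 1 one_pos
  refine ⟨L, fun g hg hgL => ?_⟩
  suffices h : A g = 1 from (LinearMap.toMatrixAlgEquiv e).injective (by rw [map_one]; exact h)
  rw [← sub_eq_zero]
  by_contra hne
  obtain ⟨i0, j0, h0⟩ : ∃ i j, (A g - 1) i j ≠ 0 := by
    by_contra! h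
    exact hne (Matrix.ext h)
  obtain ⟨⟨i, j⟩, -, hmax⟩ := Finset.exists_max_image Finset.univ
    (fun x : _ × _ => ‖(A g - 1) x.1 x.2‖) ⟨(i0, j0), Finset.mem_univ _⟩
  have hpos : 0 < ‖(A g - 1) i j‖ :=
    (norm_pos_iff.2 h0).trans_le (hmax (i0, j0) (Finset.mem_univ _))
  -- Some p-power of g is trivial on M, hence strictly closer to 1 than g was, while p-powers
  -- preserve the distance.
  obtain ⟨M, hM⟩ := hnhds _ hpos
  obtain ⟨n, hn⟩ := exists_restrict_pow_eq_one p hx hg M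
  have h1 := hM _ hn i j
  rw [map_pow, (Matrix.norm_pow_pow_sub_one_apply (PadicAlgCl.norm_natCast_eq_one hℓ) hpos
    (hL g hgL i j) (fun i' j' => hmax (i', j') (Finset.mem_univ _)) rfl n).2] at h1
  exact lt_irrefl _ h1

end Continuous
end

noncomputable section

/-! ### Averages over finite groups -/

namespace Representation

section Average

variable {F Q M : Type*} [Field F] [Group Q] [Fintype Q] [AddCommGroup M] [Module F M]

/-- The average of a representation over a finite group. -/
def mean (τ : Representation F Q M) : Module.End F M := (Fintype.card Q : F)⁻¹ • ∑ q, τ q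

theorem mul_mean (τ : Representation F Q M) (q : Q) : τ q * τ.mean = τ.mean := by
  rw [mean, mul_smul_comm, Finset.mul_sum]
  simp_rw [← map_mul]
  exact congrArg _ (Equiv.sum_comp (Equiv.mulLeft q) fun r => τ r)

theorem mean_apply_of_forall_eq [CharZero F] (τ : Representation F Q M) {v : M} (hv : ∀ q, τ q v = v) :
    τ.mean v = v := by
  have : (Fintype.card Q : F) ≠ 0 := Nat.cast_ne_zero.2 Fintype.card_ne_zero
  rw [mean, LinearMap.smul_apply, LinearMap.sum_apply, Finset.sum_congr rfl fun q _ => hv q,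
    Finset.sum_const, Finset.card_univ, ← Nat.cast_smul_eq_nsmul F, smul_smul, inv_mul_cancel₀ this,
    one_smul]

theorem mean_mul_of_forall_eq [CharZero F] (τ : Representation F Q M) {X : Module.End F M}
    (hX : ∀ q, τ q * X = X) : τ.mean * X = X :=
  LinearMap.ext fun v => τ.mean_apply_of_forall_eq fun q => LinearMap.congr_fun (hX q) v

theorem isIdempotentElem_mean [CharZero F] (τ : Representation F Q M) : IsIdempotentElem τ.mean :=
  τ.mean_mul_of_forall_eq τ.mul_mean

theorem mean_apply_mem (τ : Representation F Q M) {U : Submodule F M}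
    (hU : ∀ q, ∀ u ∈ U, τ q u ∈ U) {u : M} (hu : u ∈ U) : τ.mean u ∈ U := by
  rw [mean, LinearMap.smul_apply, LinearMap.sum_apply]
  exact U.smul_mem _ (U.sum_mem fun q _ => hU q u hu)

theorem apply_mean_apply (τ : Representation F Q M) (q : Q) (v : M) : τ q (τ.mean v) = τ.mean v :=
  LinearMap.congr_fun (τ.mul_mean q) v

theorem mul_mean_eq_mean_mul (τ : Representation F Q M) {X : Module.End F M} (c : Q ≃ Q)
    (h : ∀ q, X * τ q = τ (c q) * X) : X * τ.mean = τ.mean * X := by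
  rw [mean, mul_smul_comm, smul_mul_assoc, Finset.mul_sum, Finset.sum_mul]
  simp_rw [h]
  exact congrArg _ (Equiv.sum_comp c fun r => τ r * X)

theorem commute_mean {τ τ' : Representation F Q M} (h : ∀ q r, Commute (τ q) (τ' r)) :
    Commute τ.mean τ'.mean :=
  ((Commute.sum_left _ _ _ fun q _ => Commute.sum_right _ _ _ fun r _ => h q r).smul_left
    _).smul_right _

end Average

/-! ### Ranks of orthogonal idempotents -/

section Trace

variable {F M : Type*} [Field F] [AddCommGroup M] [Module F M] [FiniteDimensional F M]

theorem _root_.IsIdempotentElem.trace_eq_finrank_range {e : Module.End F M}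
    (he : IsIdempotentElem e) : LinearMap.trace F M e = Module.finrank F (LinearMap.range e) :=
  (LinearMap.IsIdempotentElem.isProj_range e he).trace

/-- The ranks of pairwise orthogonal idempotents with the same trace add up. -/
theorem _root_.card_mul_finrank_range_le_of_orthogonal [CharZero F] {ι : Type*} [Fintype ι]
    {e : Module.End F M} (he : IsIdempotentElem e) {f : ι → Module.End F M}
    (hf : ∀ j, IsIdempotentElem (f j)) (horth : ∀ a b, a ≠ b → f a * f b = 0)
    (htr : ∀ j, LinearMap.trace F M (f j) = LinearMap.trace F M e) :
    Fintype.card ι * Module.finrank F (LinearMap.range e) ≤ Module.finrank F M := by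
  classical
  have hsum : IsIdempotentElem (∑ j, f j) := by
    rw [IsIdempotentElem, Finset.sum_mul_sum]
    refine Finset.sum_congr rfl fun a _ => ?_
    rw [Finset.sum_eq_single a (fun b _ hb => horth a b hb.symm) (by simp)]
    exact hf a
  have h1 := hsum.trace_eq_finrank_range
  rw [map_sum, Finset.sum_congr rfl fun j _ => htr j, Finset.sum_const, Finset.card_univ,
    he.trace_eq_finrank_range, nsmul_eq_mul] at h1
  have h2 : Fintype.card ι * Module.finrank F (LinearMap.range e) =
      Module.finrank F (LinearMap.range (∑ j, f j)) := by exact_mod_cast h1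
  rw [h2]
  exact Submodule.finrank_le _

end Trace

/-! ### The twisting bound for invariants of a tensor product -/

section Tensor

variable {F Q A B : Type*} [Field F] [CharZero F] [Group Q] [Fintype Q]
  [AddCommGroup A] [Module F A] [FiniteDimensional F A]
  [AddCommGroup B] [Module F B] [FiniteDimensional F B]

/-- If twisting `β` by sufficiently independent automorphisms does not change its isomorphism
class, the invariants of `α ⊗ β` are small. -/
theorem card_mul_finrank_range_mean_tprod_le (α : Representation F Q A) (β : Representation F Q B)
    (hα : ∀ q r, Commute (α q) (α r)) (hβ : ∀ q r, Commute (β q) (β r))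
    (hfix : ∀ v, (∀ q, β q v = v) → v = 0)
    {ι : Type*} [Fintype ι] (c : ι → MulAut Q) (t t' : ι → Module.End F B)
    (htt : ∀ j, t' j * t j = 1)
    (hc : ∀ j q, β (c j q) = t j * β q * t' j)
    (hsurj : ∀ a b, a ≠ b → ∀ q, ∃ r, β q = β (c a r * (c b r)⁻¹)) :
    Fintype.card ι * Module.finrank F (LinearMap.range (α.tprod β).mean) ≤
      Module.finrank F A * Module.finrank F B := by
  let τ : ι → Representation F Q (A ⊗[F] B) := fun j =>
    α.tprod (β.comp ((c j : Q ≃* Q) : Q →* Q))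
  have hτ : ∀ j q, τ j q = TensorProduct.map (α q) (β (c j q)) := fun j q => rfl
  have hmul : ∀ (a a' : Module.End F A) (b b' : Module.End F B),
      TensorProduct.map a b * TensorProduct.map a' b' = TensorProduct.map (a * a') (b * b') :=
    fun a a' b b' => (TensorProduct.map_comp a b a' b').symm
  rw [← Module.finrank_tensorProduct (R := F) (S := F) (M := A) (M' := B)]
  refine card_mul_finrank_range_le_of_orthogonal (isIdempotentElem_mean _)
    (f := fun j => (τ j).mean) (fun j => isIdempotentElem_mean _) ?_ ?_
  · intro a b hab
    set E := (τ a).mean * (τ b).mean with hE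
    have hcomm : Commute (τ a).mean (τ b).mean := commute_mean fun q r => by
      rw [Commute, SemiconjBy, hτ, hτ, hmul, hmul, (hα q r).eq, (hβ _ _).eq]
    have h1 : ∀ r, τ a r * E = E := fun r => by rw [hE, ← mul_assoc, mul_mean]
    have h2 : ∀ r, τ b r * E = E := fun r => by rw [hE, hcomm.eq, ← mul_assoc, mul_mean]
    let β' : Representation F Q (A ⊗[F] B) := (Representation.trivial F Q A).tprod β
    have hβ' : ∀ q, β' q = TensorProduct.map 1 (β q) := fun q => rfl
    have h3 : ∀ q, β' q * E = E := by
      intro q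
      -- The image of E is fixed by both twists at r, hence by their quotient 1 ⊗ β(q).
      obtain ⟨r, hr⟩ := hsurj a b hab q
      have h4 : β' q * τ b r = τ a r := by
        rw [hβ', hτ, hτ, hmul, one_mul, hr, ← map_mul, inv_mul_cancel_right]
      rw [← h2 r, ← mul_assoc, h4, h1, h2]
    have h5 : β'.mean = 0 := by
      have h6 : β.mean = 0 := LinearMap.ext fun v => hfix _ fun q => β.apply_mean_apply q v
      have h7 : β'.mean = TensorProduct.map 1 β.mean := by
        refine TensorProduct.ext' fun x y => ?_
        simp only [mean, LinearMap.smul_apply, LinearMap.sum_apply, TensorProduct.map_tmul, hβ',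
          TensorProduct.tmul_smul, TensorProduct.tmul_sum]
      rw [h7, h6, TensorProduct.map_zero_right]
    rw [← β'.mean_mul_of_forall_eq h3, h5, zero_mul]
  · intro j
    -- The j-th projector is the untwisted one conjugated by 1 ⊗ t_j, so it has the same trace.
    have h1 : (τ j).mean = TensorProduct.map 1 (t j) * ((α.tprod β).mean *
        TensorProduct.map 1 (t' j)) := by
      rw [mean, mean, smul_mul_assoc, mul_smul_comm, Finset.sum_mul, Finset.mul_sum]
      congr 1
      refine Finset.sum_congr rfl fun q _ => ?_
      rw [hτ, tprod_apply, hmul, hmul, hc, one_mul, mul_one, mul_assoc]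
    rw [h1, LinearMap.trace_mul_comm, mul_assoc, hmul, htt, one_mul]
    congr 1
    rw [TensorProduct.map_one, mul_one]

end Tensor

/-- A representation that is trivial on `N ∩ ker f` induces a representation of a subgroup of
`f(N)`. -/
theorem exists_factor {F I G M : Type*} [Field F] [Group I] [Group G] [AddCommGroup M] [Module F M]
    (τ : Representation F I M) (f : I →* G) (N : Subgroup I) (Q : Subgroup G)
    (hker : ∀ g ∈ N, f g = 1 → τ g = 1) (hsurj : ∀ q ∈ Q, ∃ g ∈ N, f g = q) :
    ∃ α : Representation F Q M, ∀ g ∈ N, ∀ h : f g ∈ Q, α ⟨f g, h⟩ = τ g := by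
  have heq : ∀ g ∈ N, ∀ h ∈ N, f g = f h → τ g = τ h := by
    intro g hg h hh hgh
    have := hker (g * h⁻¹) (mul_mem hg (inv_mem hh)) (by rw [map_mul, map_inv, hgh, mul_inv_cancel])
    rw [← inv_mul_cancel_right g h, map_mul, this, one_mul]
  choose! l hlN hl using hsurj
  refine ⟨{ toFun := fun q => τ (l q), map_one' := ?_, map_mul' := ?_ }, fun g hg h => ?_⟩
  · exact hker _ (hlN _ Q.one_mem) (hl _ Q.one_mem)
  · intro q r
    rw [← map_mul]
    refine heq _ (hlN _ (q * r).2) _ (mul_mem (hlN _ q.2) (hlN _ r.2)) ?_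
    rw [map_mul, hl _ q.2, hl _ r.2, hl _ (q * r).2, Subgroup.coe_mul]
  · exact heq _ (hlN _ h) _ hg (hl _ h)

theorem commute_of_commutator_eq_one {F Q M : Type*} [Field F] [Group Q] [AddCommGroup M]
    [Module F M] (τ : Representation F Q M) (h : ∀ q r, τ (q * r * q⁻¹ * r⁻¹) = 1) (q r : Q) :
    Commute (τ q) (τ r) := by
  rw [Commute, SemiconjBy, ← map_mul, ← map_mul, ← one_mul (τ (r * q)), ← h q r, ← map_mul]
  congr 1
  group

/-- The restriction of a representation to a stable submodule. -/
def ofStable {F I M : Type*} [Field F] [Group I] [AddCommGroup M] [Module F M]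
    (τ : Representation F I M) (U : Submodule F M) (hU : ∀ g, ∀ u ∈ U, τ g u ∈ U) :
    Representation F I U where
  toFun g := (τ g).restrict (hU g)
  map_one' := LinearMap.ext fun u => Subtype.ext (by simp)
  map_mul' g h := LinearMap.ext fun u => Subtype.ext (by simp)

end Representation
end

noncomputable section

/-! ### Slopes -/

open AlgEquiv (restrictNormalHom)
open IsTotallyRamifiedAction

section Herbrand

variable {k : Type*} [Field k] [IsAlgClosed k]

variable (k) in
theorem herbrand_strictMono (L : Type*) [Field L] [Algebra k⸨X⸩ L] [Algebra k⟦X⟧ L]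
    [IsScalarTower k⟦X⟧ k⸨X⸩ L] [FiniteDimensional k⸨X⸩ L] [IsGalois k⸨X⸩ L] :
    StrictMono (herbrand k⟦X⟧ k⸨X⸩ L) := by
  refine strictMono_nat_of_lt_succ fun m => ?_
  have hpos : (0 : ℝ) < Nat.card Gal(L/k⸨X⸩) := by exact_mod_cast Nat.card_pos
  refine lt_of_mul_lt_mul_left ?_ hpos.le
  rw [card_mul_herbrand, card_mul_herbrand, Finset.sum_Icc_succ_top (by omega)]
  exact lt_add_of_pos_right _ (by exact_mod_cast Nat.card_pos)

theorem upperRamificationGroup_herbrand (L : Type*) [Field L] [Algebra k⸨X⸩ L] [Algebra k⟦X⟧ L]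
    [IsScalarTower k⟦X⟧ k⸨X⸩ L] [FiniteDimensional k⸨X⸩ L] [IsGalois k⸨X⸩ L] (m : ℕ) :
    upperRamificationGroup k⟦X⟧ k⸨X⸩ L (herbrand k⟦X⟧ k⸨X⸩ L m) =
      lowerRamificationGroup k⟦X⟧ k⸨X⸩ L m := by
  rw [upperRamificationGroup]
  congr 1
  refine le_antisymm (Nat.sInf_le (le_refl (herbrand k⟦X⟧ k⸨X⸩ L m))) ?_
  exact le_csInf ⟨m, le_refl (herbrand k⟦X⟧ k⸨X⸩ L m)⟩ fun j hj => (herbrand_strictMono k L).le_iff_le.1 hj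

theorem upperRamification_antitone : Antitone (upperRamification k) := by
  intro x y hxy g hg
  rw [mem_upperRamification] at hg ⊢
  intro L
  obtain ⟨ϖ, hϖ⟩ := IsDiscreteValuationRing.exists_irreducible (integralClosure k⟦X⟧ L)
  have := hg L
  rw [upperRamificationGroup, lowerRamificationGroup_eq_ram hϖ] at this ⊢
  refine ram_antitone ?_ this
  rw [sInf_le_herbrand_le_iff]
  exact hxy.trans ((sInf_le_herbrand_le_iff y _).1 le_rfl)

end Herbrand

section Slope

variable {k : Type*} [Field k] [IsAlgClosed k] {ℓ : ℕ} [Fact ℓ.Prime]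
  {V : Type*} [AddCommGroup V] [Module (PadicAlgCl ℓ) V]

local notation "𝓕" => FiniteGaloisIntermediateField k⸨X⸩ (SeparableClosure k⸨X⸩)

/-- The slope-`x` part is itself purely of slope `x`. -/
theorem isPureOfSlope_slopePart {ρ : Representation (PadicAlgCl ℓ) (InertiaGroup k) V} {x : ℝ}
    {L : 𝓕} (hL : ∀ g ∈ upperRamification k x, restrictNormalHom L g = 1 → ρ g = 1) :
    IsPureOfSlope ρ x (slopePart ρ x) where
  stable g u hu := by
    have : slopePart ρ x ≤ (slopePart ρ x).comap (ρ g) := sSup_le fun U hU u hu =>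
      le_sSup (a := U) hU (hU.stable g u hu)
    exact this hu
  trivial_above y hy g hg u hu := by
    have : slopePart ρ x ≤ LinearMap.eqLocus (ρ g) LinearMap.id := sSup_le fun U hU u hu =>
      hU.trivial_above y hy g hg u hu
    exact this hu
  no_fixed hx u hu hfix := by
    obtain ⟨α, hα⟩ := Representation.exists_factor ρ (restrictNormalHom L) (upperRamification k x)
      (upperRamificationGroup k⟦X⟧ k⸨X⸩ L x) hL fun q hq =>
        exists_mem_upperRamification_restrict_eq L hq
    have := Fintype.ofFinite (upperRamificationGroup k⟦X⟧ k⸨X⸩ L x)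
    have hαl : ∀ q : upperRamificationGroup k⟦X⟧ k⸨X⸩ L x, ∃ g ∈ upperRamification k x,
        α q = ρ g := by
      rintro ⟨q, hq⟩
      obtain ⟨g, hg, rfl⟩ := exists_mem_upperRamification_restrict_eq L hq
      exact ⟨g, hg, hα g hg hq⟩
    -- Absence of fixed vectors does not visibly pass to sums of submodules; being killed by the
    -- averaging projector does.
    have h1 : slopePart ρ x ≤ LinearMap.ker α.mean := sSup_le fun U hU u hu => by
      refine hU.no_fixed hx _ (α.mean_apply_mem (fun q v hv => ?_) hu) fun g hg => ?_
      · obtain ⟨g, -, hg⟩ := hαl q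
        rw [hg]
        exact hU.stable g v hv
      · rw [← hα g hg (mem_upperRamification.1 hg L)]
        exact α.apply_mean_apply _ _
    have h2 : α.mean u = u := α.mean_apply_of_forall_eq fun q => by
      obtain ⟨g, hg, hg'⟩ := hαl q
      rw [hg', hfix g hg]
    rw [← h2]
    exact h1 hu

variable {W : Type*} [AddCommGroup W] [Module (PadicAlgCl ℓ) W]

/-- The kernel of the averaging projector is the canonical complement of the I^(x)-invariants in A ⊗
B: it is stable because I^(x) is normal, and a fixed vector in it equals its own average, which is
zero. -/
theorem isPureOfSlope_map_ker_mean {ρ : Representation (PadicAlgCl ℓ) (InertiaGroup k) V}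
    {σ : Representation (PadicAlgCl ℓ) (InertiaGroup k) W} {x : ℝ}
    {A : Submodule (PadicAlgCl ℓ) V} (hA : IsPureOfSlope ρ x A)
    {B : Submodule (PadicAlgCl ℓ) W} (hB : IsPureOfSlope σ x B)
    {G : Type*} [Group G] {f : InertiaGroup k →* G} {Q : Subgroup G} [Fintype Q] [Q.Normal]
    (hQ : ∀ g ∈ upperRamification k x, f g ∈ Q)
    (hsurj : ∀ q ∈ Q, ∃ g ∈ upperRamification k x, f g = q)
    {α : Representation (PadicAlgCl ℓ) Q A} {β : Representation (PadicAlgCl ℓ) Q B}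
    (hα : ∀ g ∈ upperRamification k x, ∀ h : f g ∈ Q, α ⟨f g, h⟩ = ρ.ofStable A hA.stable g)
    (hβ : ∀ g ∈ upperRamification k x, ∀ h : f g ∈ Q, β ⟨f g, h⟩ = σ.ofStable B hB.stable g) :
    IsPureOfSlope (ρ.tprod σ) x ((LinearMap.ker (α.tprod β).mean).map
      (TensorProduct.map A.subtype B.subtype)) := by
  set τ := (ρ.ofStable A hA.stable).tprod (σ.ofStable B hB.stable) with hτ
  have hequiv : ∀ g, ∀ u, (ρ.tprod σ) g (TensorProduct.map A.subtype B.subtype u) =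
      TensorProduct.map A.subtype B.subtype (τ g u) := by
    intro g u
    have : (ρ.tprod σ) g ∘ₗ TensorProduct.map A.subtype B.subtype =
        TensorProduct.map A.subtype B.subtype ∘ₗ τ g := TensorProduct.ext' fun a b => rfl
    exact LinearMap.congr_fun this u
  have hinj : Function.Injective (TensorProduct.map A.subtype B.subtype) :=
    TensorProduct.map_injective_of_flat_flat _ _ A.injective_subtype B.injective_subtype
  have hτ' : ∀ g ∈ upperRamification k x, ∀ h : f g ∈ Q, (α.tprod β) ⟨f g, h⟩ = τ g := by
    intro g hg h
    rw [Representation.tprod_apply, hα g hg h, hβ g hg h]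
    rfl
  refine ⟨?_, ?_, ?_⟩
  · rintro g _ ⟨u, hu, rfl⟩
    refine ⟨τ g u, ?_, (hequiv g u).symm⟩
    have hcomm := (α.tprod β).mul_mean_eq_mean_mul (X := τ g)
      (MulAut.conjNormal (f g) : MulAut Q).toEquiv (by
        rintro ⟨q, hq⟩
        obtain ⟨h, hh, rfl⟩ := hsurj q hq
        have hh' : g * h * g⁻¹ ∈ upperRamification k x :=
          (upperRamification_normal x).conj_mem h hh g
        have hc : (MulAut.conjNormal (f g) : MulAut Q) ⟨f h, hq⟩ =
            ⟨f (g * h * g⁻¹), hQ _ hh'⟩ := Subtype.ext (by simp)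
        have h1 : (α.tprod β) ((MulAut.conjNormal (f g) : MulAut Q).toEquiv ⟨f h, hq⟩) =
            τ (g * h * g⁻¹) := by
          rw [← hτ' _ hh' (hQ _ hh'), ← hc]
          rfl
        rw [h1, hτ' h hh hq, ← map_mul, ← map_mul, inv_mul_cancel_right])
    have := LinearMap.congr_fun hcomm u
    rw [Module.End.mul_apply, Module.End.mul_apply, LinearMap.mem_ker.1 hu, map_zero] at this
    exact this.symm
  · rintro y hy g hg _ ⟨u, -, rfl⟩
    rw [hequiv]
    congr 1
    have h1 : ρ.ofStable A hA.stable g = 1 :=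
      LinearMap.ext fun a => Subtype.ext (hA.trivial_above y hy g hg a a.2)
    have h2 : σ.ofStable B hB.stable g = 1 :=
      LinearMap.ext fun b => Subtype.ext (hB.trivial_above y hy g hg b b.2)
    rw [hτ, Representation.tprod_apply, h1, h2, TensorProduct.map_one, Module.End.one_apply]
  · rintro - _ ⟨u, hu, rfl⟩ hfix
    have : (α.tprod β).mean u = u := (α.tprod β).mean_apply_of_forall_eq fun ⟨q, hq⟩ => by
      obtain ⟨g, hg, rfl⟩ := hsurj q hq
      rw [hτ' g hg hq]
      refine hinj ?_
      rw [← hequiv, hfix g hg]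
    rw [← this, LinearMap.mem_ker.1 hu, map_zero]

/-- The twisting bound for invariants, for the action of `I^(x)` through a finite group. -/
theorem mul_finrank_le_of_conj [FiniteDimensional (PadicAlgCl ℓ) V]
    [FiniteDimensional (PadicAlgCl ℓ) W] {ρ : Representation (PadicAlgCl ℓ) (InertiaGroup k) V}
    {σ : Representation (PadicAlgCl ℓ) (InertiaGroup k) W} {x : ℝ} (hx : x ≠ 0)
    {A : Submodule (PadicAlgCl ℓ) V} (hA : IsPureOfSlope ρ x A)
    {B : Submodule (PadicAlgCl ℓ) W} (hB : IsPureOfSlope σ x B)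
    {G : Type*} [Group G] {f : InertiaGroup k →* G} {Q : Subgroup G} [Finite Q] [Q.Normal]
    (hQ : ∀ g ∈ upperRamification k x, f g ∈ Q)
    (hsurj : ∀ q ∈ Q, ∃ g ∈ upperRamification k x, f g = q)
    {α : Representation (PadicAlgCl ℓ) Q A} {β : Representation (PadicAlgCl ℓ) Q B}
    (hα : ∀ g ∈ upperRamification k x, ∀ h : f g ∈ Q, α ⟨f g, h⟩ = ρ.ofStable A hA.stable g)
    (hβ : ∀ g ∈ upperRamification k x, ∀ h : f g ∈ Q, β ⟨f g, h⟩ = σ.ofStable B hB.stable g)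
    (hαc : ∀ q r, Commute (α q) (α r)) (hβc : ∀ q r, Commute (β q) (β r))
    {d : ℕ} (c : Fin d → MulAut Q) (s : Fin d → InertiaGroup k)
    (hc : ∀ j q, (c j q : G) = f (s j) * q * (f (s j))⁻¹)
    {N : Subgroup G} (hβN : ∀ q : Q, q.1 ∈ N → β q = 1)
    (hcs : ∀ a b : Fin d, a ≠ b → ∀ q : Q, ∃ r : Q, (c a r * (c b r)⁻¹ * q⁻¹).1 ∈ N) :
    d * (Module.finrank (PadicAlgCl ℓ) A * Module.finrank (PadicAlgCl ℓ) B) ≤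
      d * Module.finrank (PadicAlgCl ℓ) (slopePart (ρ.tprod σ) x) +
        Module.finrank (PadicAlgCl ℓ) A * Module.finrank (PadicAlgCl ℓ) B := by
  have := Fintype.ofFinite Q
  -- The twists are isomorphic to β since s_j itself acts on B.
  have hconj : ∀ j q, β (c j q) =
      σ.ofStable B hB.stable (s j) * β q * σ.ofStable B hB.stable (s j)⁻¹ := by
    rintro j ⟨q, hq⟩
    obtain ⟨h, hh, rfl⟩ := hsurj q hq
    have hh' : s j * h * (s j)⁻¹ ∈ upperRamification k x :=
      (upperRamification_normal _).conj_mem h hh _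
    have hc' : c j ⟨f h, hq⟩ = ⟨f (s j * h * (s j)⁻¹), hQ _ hh'⟩ :=
      Subtype.ext (by simp only [hc, map_mul, map_inv])
    rw [hc', hβ _ hh', hβ h hh, map_mul, map_mul]
  have hfix : ∀ v : B, (∀ q, β q v = v) → v = 0 := fun v hv =>
    Subtype.ext (hB.no_fixed hx v v.2 fun g hg => by
      have := hv ⟨_, hQ g hg⟩
      rw [hβ g hg] at this
      exact congrArg Subtype.val this)
  have key := Representation.card_mul_finrank_range_mean_tprod_le α β hαc hβc hfix c
    (fun j => σ.ofStable B hB.stable (s j)) (fun j => σ.ofStable B hB.stable (s j)⁻¹)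
    (fun j => by rw [← map_mul, inv_mul_cancel, map_one]) hconj (fun a b hab q => by
      obtain ⟨r, hr⟩ := hcs a b hab q
      refine ⟨r, ?_⟩
      rw [← one_mul (β q), ← hβN _ hr, ← map_mul, inv_mul_cancel_right])
  have hpure := isPureOfSlope_map_ker_mean hA hB hQ hsurj hα hβ
  have hle := Submodule.finrank_mono (show _ ≤ slopePart (ρ.tprod σ) x from le_sSup hpure)
  have hinj : Function.Injective (TensorProduct.map A.subtype B.subtype) :=
    TensorProduct.map_injective_of_flat_flat _ _ A.injective_subtype B.injective_subtype
  rw [(Submodule.equivMapOfInjective _ hinj _).finrank_eq.symm] at hle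
  have hrk := LinearMap.finrank_range_add_finrank_ker (α.tprod β).mean
  rw [Module.finrank_tensorProduct] at hrk
  rw [Fintype.card_fin] at key
  have := Nat.mul_le_mul_left d hle
  rw [← hrk, mul_add]
  rw [← hrk] at key
  omega

/-- Since G_m = G^φ(m), the image of g lifts to some h in I^(φ(m)), which acts trivially on A; and
gh⁻¹ lies in I^(x) and is trivial on L. -/
theorem apply_eq_of_restrict_mem {ρ : Representation (PadicAlgCl ℓ) (InertiaGroup k) V} {x : ℝ}
    {A : Submodule (PadicAlgCl ℓ) V} (hA : IsPureOfSlope ρ x A) {L : 𝓕}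
    (hL : ∀ g ∈ upperRamification k x, restrictNormalHom L g = 1 → ρ g = 1) {m : ℕ}
    (hm : x < herbrand k⟦X⟧ k⸨X⸩ L m) {g : InertiaGroup k} (hg : g ∈ upperRamification k x)
    (hgm : restrictNormalHom L g ∈ lowerRamificationGroup k⟦X⟧ k⸨X⸩ L m) {u : V} (hu : u ∈ A) :
    ρ g u = u := by
  rw [← upperRamificationGroup_herbrand] at hgm
  obtain ⟨h, hh, hgh⟩ := exists_mem_upperRamification_restrict_eq L hgm
  have h1 := hL (g * h⁻¹) (mul_mem hg (inv_mem (upperRamification_antitone hm.le hh)))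
    (by rw [map_mul, map_inv, hgh, mul_inv_cancel])
  rw [← inv_mul_cancel_right g h, map_mul, h1, one_mul]
  exact hA.trivial_above _ hm h hh u hu

set_option maxHeartbeats 1000000 in
/-- The action of `I^(x)` on a representation purely of slope `x` factors through the abelian
group `G_i / G_{i + 1}`, for a finite quotient `G` in which `x` is the upper number of `i`. -/
theorem exists_factor_ram {ρ : Representation (PadicAlgCl ℓ) (InertiaGroup k) V} {x : ℝ}
    {A : Submodule (PadicAlgCl ℓ) V} (hA : IsPureOfSlope ρ x A) {L : 𝓕}
    (hL : ∀ g ∈ upperRamification k x, restrictNormalHom L g = 1 → ρ g = 1)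
    {ϖ : integralClosure k⟦X⟧ L} (hϖ : Irreducible ϖ) {i : ℕ}
    (hi : x = herbrand k⟦X⟧ k⸨X⸩ L (i + 1)) :
    ∃ α : Representation (PadicAlgCl ℓ) (ram Gal(L/k⸨X⸩) ϖ (i + 1)) A,
      (∀ g ∈ upperRamification k x, ∀ h : restrictNormalHom L g ∈ ram Gal(L/k⸨X⸩) ϖ (i + 1),
        α ⟨restrictNormalHom L g, h⟩ = ρ.ofStable A hA.stable g) ∧
      (∀ q : ram Gal(L/k⸨X⸩) ϖ (i + 1), q.1 ∈ ram Gal(L/k⸨X⸩) ϖ (i + 2) → α q = 1) ∧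
      ∀ q r : ram Gal(L/k⸨X⸩) ϖ (i + 1), Commute (α q) (α r) := by
  have hsurj : ∀ q ∈ ram Gal(L/k⸨X⸩) ϖ (i + 1), ∃ g ∈ upperRamification k x,
      restrictNormalHom L g = q := fun q hq =>
    exists_mem_upperRamification_restrict_eq L (by
      rwa [hi, upperRamificationGroup_herbrand, lowerRamificationGroup_eq_ram hϖ])
  obtain ⟨α, hα⟩ := (ρ.ofStable A hA.stable).exists_factor (restrictNormalHom L)
    (upperRamification k x) (ram Gal(L/k⸨X⸩) ϖ (i + 1)) (fun g hg h =>
      LinearMap.ext fun u => Subtype.ext (LinearMap.congr_fun (hL g hg h) (u : V))) hsurj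
  have hlt : x < herbrand k⟦X⟧ k⸨X⸩ L (i + 2) :=
    hi.trans_lt (herbrand_strictMono k L (Nat.lt_succ_self _))
  have htriv : ∀ q : ram Gal(L/k⸨X⸩) ϖ (i + 1),
      q.1 ∈ ram Gal(L/k⸨X⸩) ϖ (i + 2) → α q = 1 := by
    rintro ⟨q, hq⟩ hq'
    obtain ⟨g, hg, rfl⟩ := hsurj q hq
    rw [hα g hg hq]
    refine LinearMap.ext fun u => Subtype.ext (apply_eq_of_restrict_mem hA hL hlt hg ?_ u.2)
    rwa [lowerRamificationGroup_eq_ram hϖ]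
  exact ⟨α, hα, htriv, α.commute_of_commutator_eq_one fun q r =>
    htriv _ ((isTotallyRamifiedAction hϖ).commutator_mem_ram q.2 r.2)⟩

theorem mul_finrank_le_finrank_slopePart_tprod_of_isPureOfSlope
    [FiniteDimensional (PadicAlgCl ℓ) V] [FiniteDimensional (PadicAlgCl ℓ) W] (p : ℕ)
    [Fact p.Prime] [CharP k p]
    {ρ : Representation (PadicAlgCl ℓ) (InertiaGroup k) V}
    {σ : Representation (PadicAlgCl ℓ) (InertiaGroup k) W}
    {n d : ℕ} (hn : 0 < n) (hd : 0 < d) (hnd : n.Coprime d) (hpd : p.Coprime d) {L : 𝓕}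
    (hLρ : ∀ g ∈ upperRamification k ((n : ℝ) / d), restrictNormalHom L g = 1 → ρ g = 1)
    (hLσ : ∀ g ∈ upperRamification k ((n : ℝ) / d), restrictNormalHom L g = 1 → σ g = 1)
    {A : Submodule (PadicAlgCl ℓ) V} (hA : IsPureOfSlope ρ ((n : ℝ) / d) A)
    {B : Submodule (PadicAlgCl ℓ) W} (hB : IsPureOfSlope σ ((n : ℝ) / d) B)
    {i : ℕ} (hi : (n : ℝ) / d = herbrand k⟦X⟧ k⸨X⸩ L (i + 1)) :
    d * (Module.finrank (PadicAlgCl ℓ) A * Module.finrank (PadicAlgCl ℓ) B) ≤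
      d * Module.finrank (PadicAlgCl ℓ) (slopePart (ρ.tprod σ) ((n : ℝ) / d)) +
        Module.finrank (PadicAlgCl ℓ) A * Module.finrank (PadicAlgCl ℓ) B := by
  obtain ⟨ϖ, hϖ⟩ := IsDiscreteValuationRing.exists_irreducible (integralClosure k⟦X⟧ L)
  have T := isTotallyRamifiedAction hϖ
  obtain ⟨α, hα, -, hαc⟩ := exists_factor_ram hA hLρ hϖ hi
  obtain ⟨β, hβ, hβt, hβc⟩ := exists_factor_ram hB hLσ hϖ hi
  have hup : upperRamificationGroup k⟦X⟧ k⸨X⸩ L ((n : ℝ) / d) = ram Gal(L/k⸨X⸩) ϖ (i + 1) := by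
    rw [hi, upperRamificationGroup_herbrand, lowerRamificationGroup_eq_ram hϖ]
  have hQ : ∀ g ∈ upperRamification k ((n : ℝ) / d),
      restrictNormalHom L g ∈ ram Gal(L/k⸨X⸩) ϖ (i + 1) :=
    fun g hg => hup ▸ mem_upperRamification.1 hg L
  have hsurj : ∀ q ∈ ram Gal(L/k⸨X⸩) ϖ (i + 1), ∃ g ∈ upperRamification k ((n : ℝ) / d),
      restrictNormalHom L g = q :=
    fun q hq => exists_mem_upperRamification_restrict_eq L (hup ▸ hq)
  -- The equation n/d = φ(i+1) with denominators cleared.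
  have hsum : d * ∑ j ∈ Finset.Icc 1 (i + 1), Nat.card (ram Gal(L/k⸨X⸩) ϖ j) =
      n * Nat.card (ram Gal(L/k⸨X⸩) ϖ 0) := by
    have h1 := card_mul_herbrand k L (i + 1)
    rw [← hi] at h1
    simp_rw [lowerRamificationGroup_eq_ram hϖ] at h1
    have hd' : (d : ℝ) ≠ 0 := by positivity
    have h2 : (d : ℝ) * ∑ j ∈ Finset.Icc 1 (i + 1), (Nat.card (ram Gal(L/k⸨X⸩) ϖ j) : ℝ) =
        n * Nat.card (ram Gal(L/k⸨X⸩) ϖ 0) := by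
      rw [← h1, T.ram_zero, Subgroup.card_top]
      field_simp
    exact_mod_cast h2
  obtain ⟨s, hs⟩ := T.exists_conj_surjective (residueField_natCast_eq_zero p L) hnd hpd hsum
  obtain ⟨g, rfl⟩ := AlgEquiv.restrictNormalHom_surjective (F := k⸨X⸩) (K₁ := L)
    (SeparableClosure k⸨X⸩) s
  have := T.ram_normal (i + 1)
  exact mul_finrank_le_of_conj (G := Gal(L/k⸨X⸩)) (f := restrictNormalHom L)
    (Q := ram Gal(L/k⸨X⸩) ϖ (i + 1)) (α := α) (β := β) (ne_of_gt (by positivity)) hA hB hQ hsurj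
    hα hβ hαc hβc (fun j : Fin d => T.conj (restrictNormalHom L g ^ (j : ℕ)) (i + 1))
    (fun j : Fin d => g ^ (j : ℕ)) (fun j q => by rw [T.coe_conj, map_pow]) hβt
    fun a b hab q => hs a a.2 b b.2 (fun h => hab (Fin.ext h)) q

theorem mul_finrank_le_finrank_slopePart_tprod [FiniteDimensional (PadicAlgCl ℓ) V]
    [FiniteDimensional (PadicAlgCl ℓ) W] (p : ℕ) [Fact p.Prime] [CharP k p] (hℓ : ℓ ≠ p)
    {ρ : Representation (PadicAlgCl ℓ) (InertiaGroup k) V} (hρ : IsContinuousRep ρ)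
    {σ : Representation (PadicAlgCl ℓ) (InertiaGroup k) W} (hσ : IsContinuousRep σ)
    {n d : ℕ} (hn : 0 < n) (hd : 0 < d) (hnd : n.Coprime d) (hpd : p.Coprime d) :
    d * (Module.finrank (PadicAlgCl ℓ) (slopePart ρ ((n : ℝ) / d)) *
        Module.finrank (PadicAlgCl ℓ) (slopePart σ ((n : ℝ) / d))) ≤
      d * Module.finrank (PadicAlgCl ℓ) (slopePart (ρ.tprod σ) ((n : ℝ) / d)) +
        Module.finrank (PadicAlgCl ℓ) (slopePart ρ ((n : ℝ) / d)) *
          Module.finrank (PadicAlgCl ℓ) (slopePart σ ((n : ℝ) / d)) := by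
  have hx : 0 < (n : ℝ) / d := by positivity
  obtain ⟨L₁, hL₁⟩ := exists_forall_restrict_eq_one_apply_eq_one p hℓ hρ hx
  obtain ⟨L₂, hL₂⟩ := exists_forall_restrict_eq_one_apply_eq_one p hℓ hσ hx
  have hLρ : ∀ g ∈ upperRamification k ((n : ℝ) / d),
      restrictNormalHom (L₁ ⊔ L₂ : 𝓕) g = 1 → ρ g = 1 :=
    fun g hg h => hL₁ g hg (restrictNormalHom_eq_one_of_le le_sup_left h)
  have hLσ : ∀ g ∈ upperRamification k ((n : ℝ) / d),
      restrictNormalHom (L₁ ⊔ L₂ : 𝓕) g = 1 → σ g = 1 :=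
    fun g hg h => hL₂ g hg (restrictNormalHom_eq_one_of_le le_sup_right h)
  generalize L₁ ⊔ L₂ = L at hLρ hLσ
  have hA := isPureOfSlope_slopePart hLρ
  have hB := isPureOfSlope_slopePart hLσ
  obtain ⟨i, hi, hxi⟩ := upperRamificationGroup_eq_lower_succ L hx
  -- If x < φ(i+1), then G^x = G_{i+1} is already the ramification group at φ(i+1) > x, so I^(x)
  -- acts trivially on the slope-x part and that part is zero.
  rcases hxi.lt_or_eq with hlt | heq
  · have : slopePart ρ ((n : ℝ) / d) = ⊥ := (Submodule.eq_bot_iff _).2 fun u hu =>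
      hA.no_fixed hx.ne' u hu fun g hg =>
        apply_eq_of_restrict_mem hA hLρ hlt hg (hi ▸ mem_upperRamification.1 hg L) hu
    rw [this]
    simp
  · exact mul_finrank_le_finrank_slopePart_tprod_of_isPureOfSlope p hn hd hnd hpd hLρ hLσ hA hB heq

end Slope
end

/-! ### The inequality for slope parts -/

theorem lemma2p9 (p ℓ : ℕ) [Fact p.Prime] [Fact ℓ.Prime] (hℓ : ℓ ≠ p)
    (F k : Type*) [Field F] [Finite F] [Field k] [CharP k p] [Algebra F k] [IsAlgClosure F k]
    {V W : Type*} [AddCommGroup V] [Module (PadicAlgCl ℓ) V] [FiniteDimensional (PadicAlgCl ℓ) V]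
    [AddCommGroup W] [Module (PadicAlgCl ℓ) W] [FiniteDimensional (PadicAlgCl ℓ) W]
    (ρ : Representation (PadicAlgCl ℓ) (InertiaGroup k) V) (hρ : IsContinuousRep ρ)
    (σ : Representation (PadicAlgCl ℓ) (InertiaGroup k) W) (hσ : IsContinuousRep σ)
    (n d : ℕ) (hd : 0 < d) (hnd : n.Coprime d) (hpd : p.Coprime d) (hnp : n < p) :
    (Module.finrank (PadicAlgCl ℓ) (slopePart (ρ.tprod σ) ((n : ℝ) / d)) : ℝ) ≥
      Module.finrank (PadicAlgCl ℓ) (slopePart ρ ((n : ℝ) / d)) *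
        Module.finrank (PadicAlgCl ℓ) (slopePart σ ((n : ℝ) / d)) * (1 - 1 / (d : ℝ)) := by
  have : IsAlgClosed k := IsAlgClosure.isAlgClosed F
  have hd' : (0 : ℝ) < d := by exact_mod_cast hd
  rcases Nat.eq_zero_or_pos n with rfl | hn
  -- Slope zero in lowest terms has d = 1, so the factor 1 - 1/d is zero.
  · have : d = 1 := by simpa using hnd
    rw [this]
    simp
  · have h := mul_finrank_le_finrank_slopePart_tprod p hℓ hρ hσ hn hd hnd hpd
    have h' : (d : ℝ) * (Module.finrank (PadicAlgCl ℓ) (slopePart ρ ((n : ℝ) / d)) *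
        Module.finrank (PadicAlgCl ℓ) (slopePart σ ((n : ℝ) / d))) ≤
      d * Module.finrank (PadicAlgCl ℓ) (slopePart (ρ.tprod σ) ((n : ℝ) / d)) +
        Module.finrank (PadicAlgCl ℓ) (slopePart ρ ((n : ℝ) / d)) *
          Module.finrank (PadicAlgCl ℓ) (slopePart σ ((n : ℝ) / d)) := by exact_mod_cast h
    refine le_of_mul_le_mul_left ?_ hd'
    generalize (Module.finrank (PadicAlgCl ℓ) (slopePart ρ ((n : ℝ) / d)) : ℝ) = a at h' ⊢
    generalize (Module.finrank (PadicAlgCl ℓ) (slopePart σ ((n : ℝ) / d)) : ℝ) = b at h' ⊢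
    have e : (d : ℝ) * (a * b * (1 - 1 / d)) = d * (a * b) - a * b := by field_simp
    rw [e]
    linarith
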